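/- Let $p\ge 1$ and let $f,g\in\mathbb C[x_1,\dots,x_p]$. Assume that $f$ satisfies Mahler's Hypothesis: $f$ is non-constant, $f(x)\neq0$ for all $x\in[0,\infty)^p$, and the top-degree homogeneous part of $f$ satisfies $f_{\mathrm{top}}(x)\ne0$ for all $x\in[0,\infty)^p\setminus\{0\}$. For $a\in[0,\infty)^p$ and a polynomial $h$ write $h_a(x):=h(x+a)$; then $f_a$ also satisfies Mahler's Hypothesis. Fix a continuous branch of $\log f$ on $[0,\infty)^p$ (one exists), and put $f^{-s}:=\exp(-s\log f)$. By Mahler's theorem the integral and the series $$Z(s;f,g):=\int_{[0,\infty)^p}g(x)f(x)^{-s}\,dx,\qquad \zeta(s;f,g):=\sum_{k\in\mathbb N_0^p}g(k)f(k)^{-s}$$ converge absolutely for $\operatorname{Re}(s)>(\deg g+p)/\deg f$ and have meromorphic continuations to $\mathbb C$, denoted in the same way, which are analytic outside of the set $\mathcal P(f,g)$ of possible poles, consisting of the numbers $(\deg g+p-\ell)/\deg f$ with $\ell\ge0$ an integer, other than $0,-1,-2,\dots$. (This is included in the assertion, also for $f_a,g_a$ with $a\in[0,\infty)^p$ and any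 continuous branch of $\log f_a$ on $[0,\infty)^p$.) Then the following hold. (1) (Raabe formula) For every $s\in\mathbb C\setminus\mathcal P(f,g)$, the function $t\mapsto\zeta(s;f_t,g_t)$ is integrable on $[0,1]^p$ and $$Z(s;f,g)=\int_{[0,1]^p}\zeta(s;f_t,g_t)\,dt,$$ where $dt$ is Lebesgue measure and $\zeta(s;f_t,g_t)$ is formed with the branch $\log f_t(x):=(\log f)(t+x)$. (2) For every integer $N\ge0$, the maps $a\mapsto\zeta(-N;f_a,g_a)$ and $a\mapsto Z(-N;f_a,g_a)$ are polynomials in $a=(a_1,\dots,a_p)\in[0,\infty)^p$ with complex coefficients, of degree at most $N\deg f+\deg g+p$. (These values do not depend on the branch of $\log f_a$.) (3) For every integer $N\ge0$, if the polynomial $Z(-N;f_a,g_a)$ is written as a finite sum of monomials $\sum_L c_L a^L$, with $a^L:=\prod_{i=1}^p a_i^{L_i}$ and $c_L\in\mathbb C$, then for all $a\in[0,\infty)^p$ $$\zeta(-N;f_a,g_a)=\sum_L c_L B_L(a),\qquad B_L(a):=\prod_{i=1}^p B_{L_i}(a_i),$$ where the $B_j(t)$ are the Bernoulli polynomials. In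 particular $\zeta(-N;f,g)=\sum_L c_L B_L$ with $B_L:=\prod_{i=1}^p B_{L_i}$, where $B_j=B_j(0)$ are the Bernoulli numbers (so $B_1=-\tfrac12$). -/

import Mathlib

open MeasureTheory

noncomputable section

/-- The closed octant `[0,∞)^p` in `ℝ^p`. -/
def octant (p : ℕ) : Set (Fin p → ℝ) := {x | ∀ i, 0 ≤ x i}

/-- The value `h(x)` of a complex polynomial in `p` variables at a real point `x`. -/
def evalReal {p : ℕ} (h : MvPolynomial (Fin p) ℂ) (x : Fin p → ℝ) : ℂ :=
  MvPolynomial.eval (fun i => (x i : ℂ)) h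

/-- The shifted polynomial `h_a(x) = h(x + a)`. -/
def shiftPoly {p : ℕ} (a : Fin p → ℝ) (h : MvPolynomial (Fin p) ℂ) :
    MvPolynomial (Fin p) ℂ :=
  MvPolynomial.bind₁ (fun i => MvPolynomial.X i + MvPolynomial.C (a i : ℂ)) h

/-- The top-degree homogeneous part of a polynomial. -/
def topPart {p : ℕ} (f : MvPolynomial (Fin p) ℂ) : MvPolynomial (Fin p) ℂ :=
  MvPolynomial.homogeneousComponent f.totalDegree f

/-- Mahler's Hypothesis. -/
structure MahlerHypothesis {p : ℕ} (f : MvPolynomial (Fin p) ℂ) : Prop where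
  nonconstant : 0 < f.totalDegree
  ne_zero : ∀ x ∈ octant p, evalReal f x ≠ 0
  top_ne_zero : ∀ x ∈ octant p, x ≠ 0 → evalReal (topPart f) x ≠ 0

/-- `ℓ` is a continuous branch of `log f` on the closed octant. -/
structure IsLogBranch {p : ℕ} (f : MvPolynomial (Fin p) ℂ) (ℓ : (Fin p → ℝ) → ℂ) : Prop where
  continuousOn : ContinuousOn ℓ (octant p)
  exp_eq : ∀ x ∈ octant p, Complex.exp (ℓ x) = evalReal f x

/-- `g(x) f(x)^{-s}`, where `f(x)^{-s} = exp (-s log f(x))` is formed with the branch `ℓ` of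
`log f`. -/
def zetaTerm {p : ℕ} (g : MvPolynomial (Fin p) ℂ) (ℓ : (Fin p → ℝ) → ℂ) (s : ℂ)
    (x : Fin p → ℝ) : ℂ :=
  evalReal g x * Complex.exp (-s * ℓ x)

/-- The integer point `k ∈ ℕ^p`, seen in `ℝ^p`. -/
def latticePoint {p : ℕ} (k : Fin p → ℕ) : Fin p → ℝ := fun i => (k i : ℝ)

/-- The integral of `g(x) f(x)^{-s}` over the octant (meaningful for `Re s` large). -/
def rawIntegral {p : ℕ} (g : MvPolynomial (Fin p) ℂ) (ℓ : (Fin p → ℝ) → ℂ) (s : ℂ) : ℂ :=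
  ∫ x in octant p, zetaTerm g ℓ s x

/-- The sum of `g(k) f(k)^{-s}` over `k ∈ ℕ^p` (meaningful for `Re s` large). -/
def rawSeries {p : ℕ} (g : MvPolynomial (Fin p) ℂ) (ℓ : (Fin p → ℝ) → ℂ) (s : ℂ) : ℂ :=
  ∑' k : Fin p → ℕ, zetaTerm g ℓ s (latticePoint k)

/-- The abscissa `(deg g + p) / deg f`. -/
def abscissa {p : ℕ} (f g : MvPolynomial (Fin p) ℂ) : ℝ :=
  ((g.totalDegree : ℝ) + p) / f.totalDegree

/-- `ψ` is the meromorphic continuation to `ℂ` of the restriction of `φ` to the half-plane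
`Re s > σ`. Normal form means that `ψ` has no removable singularities: at each point it is
either analytic, or has a pole (and then takes the value `0` there, by convention). -/
structure IsMeromorphicContinuation (σ : ℝ) (φ ψ : ℂ → ℂ) : Prop where
  meromorphic : MeromorphicNFOn ψ Set.univ
  eq_of_re_gt : ∀ s : ℂ, σ < s.re → ψ s = φ s

/-- A meromorphic continuation is unique. -/
theorem IsMeromorphicContinuation.unique {σ : ℝ} {φ ψ₁ ψ₂ : ℂ → ℂ}
    (h₁ : IsMeromorphicContinuation σ φ ψ₁) (h₂ : IsMeromorphicContinuation σ φ ψ₂) :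
    ψ₁ = ψ₂ := by
  have m₁ : ∀ z, MeromorphicAt ψ₁ z := fun z => (h₁.meromorphic (Set.mem_univ z)).meromorphicAt
  have m₂ : ∀ z, MeromorphicAt ψ₂ z := fun z => (h₂.meromorphic (Set.mem_univ z)).meromorphicAt
  have hm : MeromorphicOn (ψ₁ - ψ₂) Set.univ := fun z _ => (m₁ z).sub (m₂ z)
  have htop : ∀ z, meromorphicOrderAt (ψ₁ - ψ₂) z = ⊤ := by
    by_contra! hc
    obtain ⟨z, hz⟩ := hc
    have hall := (hm.exists_meromorphicOrderAt_ne_top_iff_forall isConnected_univ).1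
      ⟨⟨z, Set.mem_univ z⟩, hz⟩
    refine hall ⟨((σ + 1 : ℝ) : ℂ), Set.mem_univ _⟩ (meromorphicOrderAt_eq_top_iff.2 ?_)
    have ho : {s : ℂ | σ < s.re} ∈ nhds (((σ + 1 : ℝ) : ℂ)) :=
      (isOpen_lt continuous_const Complex.continuous_re).mem_nhds (by simp)
    filter_upwards [nhdsWithin_le_nhds ho] with s hs
    simp [h₁.eq_of_re_gt s hs, h₂.eq_of_re_gt s hs]
  funext z
  have hne : ψ₁ =ᶠ[nhdsWithin z {z}ᶜ] ψ₂ := by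
    filter_upwards [meromorphicOrderAt_eq_top_iff.1 (htop z)] with s hs
    exact sub_eq_zero.1 hs
  exact ((h₁.meromorphic (Set.mem_univ z)).eventuallyEq_nhdsNE_iff_eventuallyEq_nhds
    (h₂.meromorphic (Set.mem_univ z)) |>.1 hne).eq_of_nhds

open Classical in
/-- The meromorphic continuation to `ℂ` of the restriction of `φ` to `Re s > σ`
(the zero function if there is none). -/
def meromorphicContinuation (σ : ℝ) (φ : ℂ → ℂ) : ℂ → ℂ :=
  if h : ∃ ψ, IsMeromorphicContinuation σ φ ψ then h.choose else 0

/-- The zeta integral `Z(s; f, g)` as a meromorphic function of `s`, with `f^{-s}` formed by means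
of the branch `ℓ` of `log f`. -/
def zetaIntegral {p : ℕ} (f g : MvPolynomial (Fin p) ℂ) (ℓ : (Fin p → ℝ) → ℂ) : ℂ → ℂ :=
  meromorphicContinuation (abscissa f g) (rawIntegral g ℓ)

/-- The Dirichlet series `ζ(s; f, g)` as a meromorphic function of `s`, with `f^{-s}` formed by
means of the branch `ℓ` of `log f`. -/
def zetaSeries {p : ℕ} (f g : MvPolynomial (Fin p) ℂ) (ℓ : (Fin p → ℝ) → ℂ) : ℂ → ℂ :=
  meromorphicContinuation (abscissa f g) (rawSeries g ℓ)

/-- The possible poles: the numbers `(deg g + p - l) / deg f` with `l ≥ 0` an integer, other than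
the non-positive integers. -/
def possiblePoles {p : ℕ} (f g : MvPolynomial (Fin p) ℂ) : Set ℂ :=
  {s | (∃ l : ℕ, s = ((g.totalDegree : ℂ) + p - l) / f.totalDegree) ∧ ∀ N : ℕ, s ≠ -(N : ℂ)}

/-- `Z(s; f, g)` and `ζ(s; f, g)` are well defined: the integral and the series converge
absolutely for `Re s > (deg g + p) / deg f`, and they have meromorphic continuations to `ℂ`,
which are analytic outside of the set of possible poles. -/
structure ZetaWellDefined {p : ℕ} (f g : MvPolynomial (Fin p) ℂ) (ℓ : (Fin p → ℝ) → ℂ) :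
    Prop where
  integrableOn : ∀ s : ℂ, abscissa f g < s.re → IntegrableOn (zetaTerm g ℓ s) (octant p)
  summable : ∀ s : ℂ, abscissa f g < s.re →
    Summable fun k : Fin p → ℕ => zetaTerm g ℓ s (latticePoint k)
  integral_continuation :
    IsMeromorphicContinuation (abscissa f g) (rawIntegral g ℓ) (zetaIntegral f g ℓ)
  series_continuation :
    IsMeromorphicContinuation (abscissa f g) (rawSeries g ℓ) (zetaSeries f g ℓ)
  integral_analyticAt : ∀ s ∉ possiblePoles f g, AnalyticAt ℂ (zetaIntegral f g ℓ) s
  series_analyticAt : ∀ s ∉ possiblePoles f g, AnalyticAt ℂ (zetaSeries f g ℓ) s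

/-- `B_L(a) = ∏ B_{L_i}(a_i)`, a product of Bernoulli polynomials. -/
def bernoulliProd {p : ℕ} (L : Fin p →₀ ℕ) (a : Fin p → ℝ) : ℂ :=
  ∏ i, Polynomial.aeval (a i : ℂ) (Polynomial.bernoulli (L i))

end

/-! Write d for the degree of f. The proof works with the class of functions `∑ n, (s)_n u_n
f^{-s-n}`, where u_n is a polynomial of degree at most m + nd; these are the symbols of order m
(`FormalSymbol.ofOrder`). On the octant such a function is O((1 + ‖x‖)^(m - d Re s)), locally
uniformly in s (`norm_eval_le`). This needs a lower bound for |f|, which comes from Mahler's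
Hypothesis, and a bound for Im log f, which holds because the argument of a polynomial of degree at
most d varies by at most πd along a ray on which it has no zeros. Each partial derivative lowers the
order by one. At s = -N a symbol of order m with m + Nd < 0 vanishes identically
(`eval_neg_natCast_eq_zero`): the Pochhammer factor kills the terms with n > N, and for n ≤ N the
degree bound is negative.

Integrals are continued by scaling. Differentiating ∫ u(cx) dx = c^(-p) ∫ u at c = 1 shows that (m +
p - sd) ∫ u is the integral of a symbol of order m - 1 (`integral_euler`), so each step gains 1/d
and costs at most one pole, at (m + p)/d. If that point is some -N, the new symbol vanishes there
and no pole arises.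

Series are continued by comparison with integrals. Expand u(k + t) by Taylor's formula, integrate
over t in the unit cube and sum over the lattice points k (`integral_octant_eq`). The left side is
the integral of u over the octant. On the right, the term of order 0 is the series of u, the higher
terms are series of symbols of lower order, and the remainder is holomorphic in a half-plane as far
to the left as desired.

The same expansion, with t as the shift, gives the rest. At s = -N the remainder vanishes and the
continuation is a polynomial in the shift (`exists_polynomial_value`). Integrating over the cube and
comparing with the expansion of the integral gives Raabe's formula for the continuations
(`integral_cube_continuation`). At s = -N, Raabe's formula says that P is the average of Q over
translates of the unit cube, where P and Q are the polynomials of values of Z and ζ. This averaging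
sends B_L to a^L, and the products B_L span all polynomials, so Q is obtained from P by replacing
each a^L with B_L(a) (`evalReal_eq_bernoulliEval`). -/

/-- Polynomials all of whose monomials have degree at most the integer `k`. -/
def degLE {p : ℕ} (k : ℤ) : Submodule ℂ (MvPolynomial (Fin p) ℂ) where
  carrier := {g | ∀ L, g.coeff L ≠ 0 → (L.degree : ℤ) ≤ k}
  zero_mem' := by simp
  add_mem' := by
    intro a b ha hb L hL
    by_cases h : a.coeff L = 0
    · exact hb L fun h' => hL (by simp [h, h'])
    · exact ha L h
  smul_mem' := by
    intro c a ha L hL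
    exact ha L fun h' => hL (by simp [h'])

/-! ### Degree bounds and the Euler operator -/

section DegLE

variable {p : ℕ} {k k' : ℤ} {g h : MvPolynomial (Fin p) ℂ}

theorem degLE_mono (hk : k ≤ k') (hg : g ∈ degLE k) : g ∈ degLE k' :=
  fun L hL => (hg L hL).trans hk

theorem mem_degLE_totalDegree_iff {n : ℕ} : g ∈ degLE (n : ℤ) ↔ g.totalDegree ≤ n := by
  rw [MvPolynomial.totalDegree, Finset.sup_le_iff]
  constructor
  · intro hg L hL
    have := hg L (MvPolynomial.mem_support_iff.1 hL)
    exact_mod_cast this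
  · intro hg L hL
    have := hg L (MvPolynomial.mem_support_iff.2 hL)
    exact_mod_cast this

theorem mem_degLE_totalDegree : g ∈ degLE (g.totalDegree : ℤ) :=
  mem_degLE_totalDegree_iff.2 le_rfl

/-- Negative bounds are the reason for taking `k` in `ℤ`: they force the vanishing of symbols at
non-positive integers. -/
theorem eq_zero_of_mem_degLE (hk : k < 0) (hg : g ∈ degLE k) : g = 0 := by
  ext L
  by_contra hL
  have := hg L hL
  omega

theorem monomial_mem_degLE {L : Fin p →₀ ℕ} (hL : (L.degree : ℤ) ≤ k) (c : ℂ) :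
    MvPolynomial.monomial L c ∈ degLE k := by
  intro L' h
  rw [MvPolynomial.coeff_monomial] at h
  split_ifs at h with h'
  · rwa [← h']
  · exact absurd rfl h

/-- To prove that a linear construction respects degrees it suffices to treat monomials. -/
theorem degLE_induction {P : MvPolynomial (Fin p) ℂ → Prop} (zero : P 0)
    (add : ∀ a b, P a → P b → P (a + b))
    (mono : ∀ (L : Fin p →₀ ℕ) (c : ℂ), (L.degree : ℤ) ≤ k → P (MvPolynomial.monomial L c))
    (hg : g ∈ degLE k) : P g := by
  rw [g.as_sum]
  exact Finset.sum_induction _ P add zero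
    fun L hL => mono L _ (hg L (MvPolynomial.mem_support_iff.1 hL))

theorem mul_mem_degLE (hg : g ∈ degLE k) (hh : h ∈ degLE k') : g * h ∈ degLE (k + k') := by
  intro L hL
  rw [MvPolynomial.coeff_mul] at hL
  obtain ⟨⟨a, b⟩, hab, hne⟩ := Finset.exists_ne_zero_of_sum_ne_zero hL
  have h1 := hg a (left_ne_zero_of_mul hne)
  have h2 := hh b (right_ne_zero_of_mul hne)
  replace hab : a + b = L := by simpa using hab
  rw [← hab, map_add]
  push_cast
  exact add_le_add h1 h2

theorem pderiv_mem_degLE (i : Fin p) (hg : g ∈ degLE k) : MvPolynomial.pderiv i g ∈ degLE (k - 1) := by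
  intro L hL
  rw [MvPolynomial.coeff_pderiv] at hL
  have := hg _ (left_ne_zero_of_mul hL)
  rw [map_add, Finsupp.degree_single] at this
  push_cast at this
  omega

/-- The Euler operator `∑ x_i ∂_i`. -/
noncomputable def eulerOp : MvPolynomial (Fin p) ℂ →ₗ[ℂ] MvPolynomial (Fin p) ℂ :=
  ∑ i, LinearMap.mulLeft ℂ (MvPolynomial.X i) ∘ₗ (MvPolynomial.pderiv i).toLinearMap

theorem eulerOp_apply (g : MvPolynomial (Fin p) ℂ) :
    eulerOp g = ∑ i, MvPolynomial.X i * MvPolynomial.pderiv i g := by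
  simp [eulerOp]

theorem eulerOp_monomial (L : Fin p →₀ ℕ) (c : ℂ) :
    eulerOp (MvPolynomial.monomial L c) = (L.degree : ℂ) • MvPolynomial.monomial L c := by
  simp only [eulerOp_apply, MvPolynomial.X_mul_pderiv_monomial]
  rw [← Finset.sum_smul, Finsupp.degree_eq_sum, Nat.cast_smul_eq_nsmul]

/-- Monomials are eigenvectors of the Euler operator, with their degree as eigenvalue, so those of
degree exactly `k` cancel. -/
theorem smul_sub_eulerOp_mem (hg : g ∈ degLE k) : (k : ℂ) • g - eulerOp g ∈ degLE (k - 1) := by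
  refine degLE_induction (P := fun g => (k : ℂ) • g - eulerOp g ∈ degLE (k - 1)) ?_ ?_ ?_ hg
  · simp
  · intro a b ha hb
    rw [map_add, smul_add, add_sub_add_comm]
    exact add_mem ha hb
  · intro L c hL
    rw [eulerOp_monomial, ← sub_smul, MvPolynomial.smul_monomial]
    rcases hL.lt_or_eq with h | h
    · exact monomial_mem_degLE (by omega) _
    · rw [← h]; simp

theorem norm_evalReal_le (hg : g ∈ degLE k) :
    ∃ C : ℝ, 0 ≤ C ∧ ∀ x : Fin p → ℝ, ‖evalReal g x‖ ≤ C * (1 + ‖x‖) ^ (k : ℝ) := by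
  refine degLE_induction (P := fun g => ∃ C : ℝ, 0 ≤ C ∧ ∀ x : Fin p → ℝ,
    ‖evalReal g x‖ ≤ C * (1 + ‖x‖) ^ (k : ℝ)) ?_ ?_ ?_ hg
  · exact ⟨0, le_rfl, by simp [evalReal]⟩
  · rintro a b ⟨A, hA, ha⟩ ⟨B, hB, hb⟩
    refine ⟨A + B, add_nonneg hA hB, fun x => ?_⟩
    rw [evalReal, map_add, add_mul]
    exact (norm_add_le _ _).trans (add_le_add (ha x) (hb x))
  · intro L c hL
    refine ⟨‖c‖, norm_nonneg _, fun x => ?_⟩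
    rw [evalReal, MvPolynomial.eval_monomial, norm_mul]
    gcongr
    rw [Finsupp.prod_fintype _ _ (by simp), norm_prod]
    have h1 : 1 ≤ 1 + ‖x‖ := by simp
    calc ∏ i, ‖((x i : ℝ) : ℂ) ^ L i‖ ≤ ∏ i, (1 + ‖x‖) ^ L i := by
          refine Finset.prod_le_prod (fun _ _ => norm_nonneg _) fun i _ => ?_
          rw [norm_pow, Complex.norm_real]
          gcongr
          linarith [norm_le_pi_norm x i]
      _ = (1 + ‖x‖) ^ ((L.degree : ℤ) : ℝ) := by
          rw [Finset.prod_pow_eq_pow_sum, ← Finsupp.degree_eq_sum, Int.cast_natCast, Real.rpow_natCast]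
      _ ≤ (1 + ‖x‖) ^ (k : ℝ) := Real.rpow_le_rpow_of_exponent_le h1 (by exact_mod_cast hL)

end DegLE

/-! ### Evaluation, shifts and derivatives along lines -/

section Eval

variable {p : ℕ}

theorem evalReal_shiftPoly (a : Fin p → ℝ) (h : MvPolynomial (Fin p) ℂ) (x : Fin p → ℝ) :
    evalReal (shiftPoly a h) x = evalReal h (a + x) := by
  rw [evalReal, shiftPoly, MvPolynomial.eval, MvPolynomial.eval₂Hom_bind₁]
  simp only [evalReal, MvPolynomial.eval]
  congr 2
  ext i
  simp [add_comm]

theorem shiftPoly_zero (h : MvPolynomial (Fin p) ℂ) : shiftPoly 0 h = h := by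
  simp only [shiftPoly, Pi.zero_apply, Complex.ofReal_zero, map_zero, add_zero]
  exact MvPolynomial.aeval_X_left_apply h

theorem shiftPoly_shiftPoly (a b : Fin p → ℝ) (h : MvPolynomial (Fin p) ℂ) :
    shiftPoly b (shiftPoly a h) = shiftPoly (a + b) h := by
  rw [shiftPoly, shiftPoly, MvPolynomial.bind₁_bind₁, shiftPoly]
  congr 2
  ext i : 1
  simp
  ring

theorem continuous_evalReal (h : MvPolynomial (Fin p) ℂ) : Continuous (evalReal h) :=
  (MvPolynomial.continuous_eval h).comp (by fun_prop)

theorem shiftPoly_totalDegree_le (a : Fin p → ℝ) (h : MvPolynomial (Fin p) ℂ) :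
    (shiftPoly a h).totalDegree ≤ h.totalDegree := by
  rw [← mem_degLE_totalDegree_iff]
  refine degLE_induction (P := fun g => shiftPoly a g ∈ degLE (h.totalDegree : ℤ)) ?_ ?_ ?_
    mem_degLE_totalDegree
  · simp [shiftPoly]
  · intro u v hu hv
    rw [shiftPoly, map_add]
    exact add_mem hu hv
  · intro L c hL
    rw [mem_degLE_totalDegree_iff, shiftPoly, MvPolynomial.bind₁_monomial]
    refine (MvPolynomial.totalDegree_mul _ _).trans ?_
    rw [MvPolynomial.totalDegree_C, zero_add]
    refine (MvPolynomial.totalDegree_finsetProd _ _).trans ?_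
    have hL' : L.degree ≤ h.totalDegree := by exact_mod_cast hL
    refine le_trans (Finset.sum_le_sum fun i _ => ?_) hL'
    refine (MvPolynomial.totalDegree_pow _ _).trans ?_
    have : (MvPolynomial.X i + MvPolynomial.C (a i : ℂ) : MvPolynomial (Fin p) ℂ).totalDegree ≤ 1 :=
      (MvPolynomial.totalDegree_add _ _).trans (by simp)
    calc _ ≤ L i * 1 := Nat.mul_le_mul_left _ this
      _ = L i := mul_one _

theorem shiftPoly_totalDegree (a : Fin p → ℝ) (h : MvPolynomial (Fin p) ℂ) :
    (shiftPoly a h).totalDegree = h.totalDegree := by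
  refine (shiftPoly_totalDegree_le a h).antisymm ?_
  calc h.totalDegree = (shiftPoly (-a) (shiftPoly a h)).totalDegree := by
        rw [shiftPoly_shiftPoly, add_neg_cancel, shiftPoly_zero]
    _ ≤ _ := shiftPoly_totalDegree_le _ _

theorem evalReal_hasDerivAt_line (g : MvPolynomial (Fin p) ℂ) (x t : Fin p → ℝ) (τ : ℝ) :
    HasDerivAt (fun τ : ℝ => evalReal g (x + τ • t))
      (∑ i, (t i : ℂ) * evalReal (MvPolynomial.pderiv i g) (x + τ • t)) τ := by
  induction g using MvPolynomial.induction_on with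
  | C a => simpa [evalReal] using hasDerivAt_const τ a
  | add a b ha hb =>
    simp only [evalReal, map_add, mul_add, Finset.sum_add_distrib] at ha hb ⊢
    exact ha.add hb
  | mul_X a i ha =>
    have h1 : HasDerivAt (fun τ : ℝ => (((x + τ • t) i : ℝ) : ℂ)) (t i : ℂ) τ := by
      have : HasDerivAt (fun τ : ℝ => (x + τ • t) i) (t i) τ := by
        simpa using ((hasDerivAt_id τ).mul_const (t i)).const_add (x i)
      exact this.ofReal_comp
    have := ha.mul h1
    simp only [evalReal, map_mul, MvPolynomial.eval_X, Derivation.leibniz, smul_eq_mul, map_add,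
      MvPolynomial.pderiv_X] at this ⊢
    refine this.congr_deriv ?_
    rw [Finset.sum_mul, Finset.sum_congr rfl fun j _ => mul_add _ _ _, Finset.sum_add_distrib,
      add_comm]
    congr 1
    · rw [Finset.sum_eq_single i (fun j _ hj => by simp [hj.symm]) (by simp)]
      simp [mul_comm]
    · exact Finset.sum_congr rfl fun j _ => by ring

end Eval

/-! ### Geometry of the octant -/

section Octant

variable {p : ℕ}

theorem octant_eq_Ici : octant p = Set.Ici 0 := rfl

theorem measurableSet_octant : MeasurableSet (octant p) := by
  rw [octant_eq_Ici]; exact measurableSet_Ici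

theorem isClosed_octant : IsClosed (octant p) := by
  rw [octant_eq_Ici]; exact isClosed_Ici

theorem convex_octant : Convex ℝ (octant p) := by
  rw [octant_eq_Ici]; exact convex_Ici 0

theorem zero_mem_octant : (0 : Fin p → ℝ) ∈ octant p := fun _ => le_rfl

theorem add_mem_octant {x t : Fin p → ℝ} (hx : x ∈ octant p) (ht : t ∈ octant p) :
    x + t ∈ octant p := fun i => add_nonneg (hx i) (ht i)

theorem smul_mem_octant {x : Fin p → ℝ} (hx : x ∈ octant p) {c : ℝ} (hc : 0 ≤ c) :
    c • x ∈ octant p := fun i => mul_nonneg hc (hx i)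

/-- Adding non-negative coordinates cannot decrease a non-negative vector. Hence lower bounds
survive shifts with the same constant, and a decaying bound at `x` also serves along the whole
segment from `x` to `x + t`. -/
theorem norm_le_norm_add_of_mem_octant {x t : Fin p → ℝ} (hx : x ∈ octant p) (ht : t ∈ octant p) :
    ‖x‖ ≤ ‖x + t‖ := by
  refine (pi_norm_le_iff_of_nonneg (norm_nonneg _)).2 fun i => ?_
  refine le_trans ?_ (norm_le_pi_norm (x + t) i)
  rw [Real.norm_of_nonneg (hx i), Pi.add_apply, Real.norm_of_nonneg (add_nonneg (hx i) (ht i))]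
  linarith [ht i]

theorem latticePoint_mem_octant (k : Fin p → ℕ) : latticePoint k ∈ octant p :=
  fun i => Nat.cast_nonneg (k i)

/-- The retraction of `ℝ^p` onto the octant. -/
def octantProj (x : Fin p → ℝ) : Fin p → ℝ := fun i => max (x i) 0

theorem octantProj_mem (x : Fin p → ℝ) : octantProj x ∈ octant p := fun _ => le_max_right _ _

theorem octantProj_eq {x : Fin p → ℝ} (hx : x ∈ octant p) : octantProj x = x :=
  funext fun i => max_eq_left (hx i)

theorem continuous_octantProj : Continuous (octantProj (p := p)) := by
  unfold octantProj; fun_prop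

end Octant

/-! ### Mahler's Hypothesis as a lower bound -/

/-- `f` is bounded below on the octant by a multiple of `(1 + ‖x‖) ^ deg f`, and not constant. -/
structure IsEllipticOnOctant {p : ℕ} (f : MvPolynomial (Fin p) ℂ) : Prop where
  nonconstant : 0 < f.totalDegree
  lower_bound : ∃ c : ℝ, 0 < c ∧ ∀ x ∈ octant p, c * (1 + ‖x‖) ^ f.totalDegree ≤ ‖evalReal f x‖

section Elliptic

variable {p : ℕ} {f : MvPolynomial (Fin p) ℂ}

theorem IsEllipticOnOctant.evalReal_ne_zero (hf : IsEllipticOnOctant f) {x : Fin p → ℝ}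
    (hx : x ∈ octant p) : evalReal f x ≠ 0 := by
  obtain ⟨c, hc, h⟩ := hf.lower_bound
  rw [← norm_pos_iff]
  exact lt_of_lt_of_le (by positivity) (h x hx)

/-- This stability is the advantage of the lower bound over Mahler's Hypothesis: neither the degree
nor the constant changes. -/
theorem IsEllipticOnOctant.shift (hf : IsEllipticOnOctant f) {a : Fin p → ℝ} (ha : a ∈ octant p) :
    IsEllipticOnOctant (shiftPoly a f) := by
  refine ⟨by rw [shiftPoly_totalDegree]; exact hf.nonconstant, ?_⟩
  obtain ⟨c, hc, h⟩ := hf.lower_bound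
  refine ⟨c, hc, fun x hx => ?_⟩
  rw [evalReal_shiftPoly, shiftPoly_totalDegree]
  refine le_trans ?_ (h _ (add_mem_octant ha hx))
  gcongr
  rw [add_comm]
  exact norm_le_norm_add_of_mem_octant hx ha

theorem evalReal_topPart_smul (r : ℝ) (x : Fin p → ℝ) :
    evalReal (topPart f) (r • x) = (r : ℂ) ^ f.totalDegree * evalReal (topPart f) x := by
  have h := MvPolynomial.homogeneousComponent_isHomogeneous f.totalDegree f
  rw [evalReal, evalReal, MvPolynomial.eval_eq', MvPolynomial.eval_eq', Finset.mul_sum]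
  refine Finset.sum_congr rfl fun L hL => ?_
  have hd : L.degree = f.totalDegree := by
    rw [Finsupp.degree_eq_weight_one]
    exact h (MvPolynomial.mem_support_iff.1 hL)
  have : ∏ i, (((r • x) i : ℝ) : ℂ) ^ L i = (r : ℂ) ^ f.totalDegree * ∏ i, (x i : ℂ) ^ L i := by
    rw [← hd, Finsupp.degree_eq_sum, ← Finset.prod_pow_eq_pow_sum, ← Finset.prod_mul_distrib]
    exact Finset.prod_congr rfl fun i _ => by simp [mul_pow]
  rw [this]
  ring

theorem sub_topPart_mem_degLE : f - topPart f ∈ degLE ((f.totalDegree : ℤ) - 1) := by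
  intro L hL
  rw [MvPolynomial.coeff_sub, topPart, MvPolynomial.coeff_homogeneousComponent] at hL
  have hd : L.degree ≠ f.totalDegree := fun h => by simp [h] at hL
  rw [if_neg hd, sub_zero] at hL
  have := mem_degLE_totalDegree (g := f) L hL
  omega

/-- By homogeneity and compactness of the unit sphere in the octant, the top part is at least a
multiple of ‖x‖^d. It dominates the lower terms outside a large ball; inside the ball, compactness
and the absence of zeros suffice. -/
theorem MahlerHypothesis.isEllipticOnOctant (hf : MahlerHypothesis f) : IsEllipticOnOctant f := by
  refine ⟨hf.nonconstant, ?_⟩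
  set d := f.totalDegree with hd
  have hcont := continuous_evalReal f
  -- lower bound for the top part on the unit sphere
  obtain ⟨c₁, hc₁, h₁⟩ : ∃ c : ℝ, 0 < c ∧ ∀ x ∈ octant p,
      c * ‖x‖ ^ d ≤ ‖evalReal (topPart f) x‖ := by
    have hK : IsCompact (Metric.sphere (0 : Fin p → ℝ) 1 ∩ octant p) :=
      (isCompact_sphere _ _).inter_right isClosed_octant
    obtain ⟨c, hc, h⟩ : ∃ c : ℝ, 0 < c ∧ ∀ x ∈ Metric.sphere (0 : Fin p → ℝ) 1 ∩ octant p,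
        c ≤ ‖evalReal (topPart f) x‖ := by
      -- The intersection is empty when `p = 0`.
      rcases (Metric.sphere (0 : Fin p → ℝ) 1 ∩ octant p).eq_empty_or_nonempty with he | hne
      · exact ⟨1, one_pos, by simp [he]⟩
      · obtain ⟨x₀, hx₀, hmin⟩ := hK.exists_isMinOn hne
          (continuous_evalReal (topPart f)).norm.continuousOn
        refine ⟨_, norm_pos_iff.2 (hf.top_ne_zero x₀ hx₀.2 ?_), fun x hx => hmin hx⟩
        rintro rfl
        simp at hx₀
    refine ⟨c, hc, fun x hx => ?_⟩
    rcases eq_or_ne x 0 with rfl | hx0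
    · rw [norm_zero, zero_pow hf.nonconstant.ne', mul_zero]
      exact norm_nonneg _
    · have hn : 0 < ‖x‖ := norm_pos_iff.2 hx0
      have := h (‖x‖⁻¹ • x) ⟨by simp [norm_smul, hn.ne'], smul_mem_octant hx (by positivity)⟩
      rw [evalReal_topPart_smul, norm_mul, norm_pow, Complex.norm_real, norm_inv, norm_norm,
        inv_pow, inv_mul_eq_div, le_div_iff₀ (by positivity)] at this
      exact this
  obtain ⟨C, hC, h₂⟩ := norm_evalReal_le (sub_topPart_mem_degLE (f := f))
  -- outside a large ball
  have hfar : ∀ x ∈ octant p, 1 ≤ ‖x‖ → 2 ^ (d + 1) * C ≤ c₁ * (1 + ‖x‖) →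
      c₁ / 2 ^ (d + 1) * (1 + ‖x‖) ^ d ≤ ‖evalReal f x‖ := by
    intro x hx h1 hR
    have e1 := h₁ x hx
    have e2 := h₂ x
    have e3 : evalReal (topPart f) x = evalReal f x - evalReal (f - topPart f) x := by
      simp [evalReal]
    have e4 : ‖evalReal (topPart f) x‖ ≤ ‖evalReal f x‖ + ‖evalReal (f - topPart f) x‖ := by
      rw [e3]; exact norm_sub_le _ _
    have e5 : (1 + ‖x‖) ^ d ≤ 2 ^ d * ‖x‖ ^ d := by
      rw [← mul_pow]; gcongr; linarith
    have hpos : 0 < 1 + ‖x‖ := by positivity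
    have e6 : (1 + ‖x‖) ^ (((d : ℤ) - 1 : ℤ) : ℝ) * (1 + ‖x‖) = (1 + ‖x‖) ^ d := by
      push_cast
      rw [Real.rpow_sub hpos, Real.rpow_one, Real.rpow_natCast, div_mul_cancel₀ _ hpos.ne']
    set A := (1 + ‖x‖) ^ (((d : ℤ) - 1 : ℤ) : ℝ) with hA
    have hA0 : 0 ≤ A := by positivity
    have e7 : 2 ^ (d + 1) * (C * A) ≤ c₁ * (1 + ‖x‖) ^ d := by
      rw [← e6]; nlinarith
    have h2d : (0 : ℝ) < 2 ^ d := by positivity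
    have e8 : c₁ * (1 + ‖x‖) ^ d ≤ 2 ^ d * (c₁ * ‖x‖ ^ d) := by nlinarith
    rw [div_mul_eq_mul_div, div_le_iff₀ (by positivity)]
    rw [pow_succ] at e7 ⊢
    nlinarith
  -- Beyond this radius the lower terms are at most half of the bound `c₁ / 2 ^ d * (1 + ‖x‖) ^ d`
  -- for the top part.
  set R := max 1 (2 ^ (d + 1) * C / c₁) with hR
  obtain ⟨c₂, hc₂, h₃⟩ : ∃ c : ℝ, 0 < c ∧ ∀ x ∈ octant p, ‖x‖ ≤ R → c ≤ ‖evalReal f x‖ := by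
    have hK : IsCompact (Metric.closedBall (0 : Fin p → ℝ) R ∩ octant p) :=
      (isCompact_closedBall _ _).inter_right isClosed_octant
    obtain ⟨x₀, hx₀, hmin⟩ := hK.exists_isMinOn
      ⟨0, by simp [hR], zero_mem_octant⟩ hcont.norm.continuousOn
    exact ⟨_, norm_pos_iff.2 (hf.ne_zero x₀ hx₀.2), fun x hx hxR => hmin ⟨by simpa using hxR, hx⟩⟩
  refine ⟨min (c₁ / 2 ^ (d + 1)) (c₂ / (1 + R) ^ d), by positivity, fun x hx => ?_⟩
  rcases le_total ‖x‖ R with hle | hge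
  · refine le_trans ?_ (h₃ x hx hle)
    calc _ ≤ c₂ / (1 + R) ^ d * (1 + R) ^ d := by
          gcongr
          exact min_le_right _ _
      _ = c₂ := div_mul_cancel₀ _ (by positivity)
  · refine le_trans ?_ (hfar x hx ((le_max_left _ _).trans hge) ?_)
    · gcongr
      exact min_le_left _ _
    · have := (le_max_right _ _).trans hge
      rw [div_le_iff₀ hc₁] at this
      nlinarith

end Elliptic

/-! ### Branches of the logarithm -/

section LogBranch

/-- Two continuous logarithms of the same function on a connected set differ by a constant. -/
theorem exists_int_eq_add_of_exp_eq {X : Type*} [TopologicalSpace X] {S : Set X}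
    (hS : IsPreconnected S) {ℓ₁ ℓ₂ : X → ℂ} (h₁ : ContinuousOn ℓ₁ S) (h₂ : ContinuousOn ℓ₂ S)
    (h : ∀ x ∈ S, Complex.exp (ℓ₁ x) = Complex.exp (ℓ₂ x)) :
    ∃ k : ℤ, ∀ x ∈ S, ℓ₁ x = ℓ₂ x + k * (2 * Real.pi * Complex.I) := by
  rcases S.eq_empty_or_nonempty with rfl | ⟨x₀, hx₀⟩
  · exact ⟨0, by simp⟩
  have hk : ∀ x ∈ S, ∃ k : ℤ, ℓ₁ x = ℓ₂ x + k * (2 * Real.pi * Complex.I) :=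
    fun x hx => Complex.exp_eq_exp_iff_exists_int.1 (h x hx)
  obtain ⟨k, hk₀⟩ := hk x₀ hx₀
  have hmaps : Set.MapsTo (fun x => ℓ₁ x - ℓ₂ x) S
      (AddSubgroup.zmultiples (2 * Real.pi * Complex.I) : Set ℂ) := by
    intro x hx
    obtain ⟨n, hn⟩ := hk x hx
    exact ⟨n, by simp [hn]⟩
  have hdisc : DiscreteTopology (AddSubgroup.zmultiples (2 * Real.pi * Complex.I) : Set ℂ) :=
    NormedSpace.discreteTopology_zmultiples _
  refine ⟨k, fun x hx => ?_⟩
  have := hS.constant_of_mapsTo ⟨hdisc⟩ (h₁.sub h₂) hmaps hx hx₀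
  simp only [Pi.sub_apply, hk₀] at this
  linear_combination this

theorem IsLogBranch.eq_add_const {p : ℕ} {f : MvPolynomial (Fin p) ℂ} {ℓ₁ ℓ₂ : (Fin p → ℝ) → ℂ}
    (h₁ : IsLogBranch f ℓ₁) (h₂ : IsLogBranch f ℓ₂) :
    ∃ k : ℤ, ∀ x ∈ octant p, ℓ₁ x = ℓ₂ x + k * (2 * Real.pi * Complex.I) :=
  exists_int_eq_add_of_exp_eq convex_octant.isPreconnected h₁.continuousOn h₂.continuousOn
    fun x hx => (h₁.exp_eq x hx).trans (h₂.exp_eq x hx).symm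

/-- Precomposing with the retraction gives a zero-free continuous function on the simply connected
space ℝ^p, which lifts through the covering `exp`. -/
theorem IsEllipticOnOctant.exists_isLogBranch {p : ℕ} {f : MvPolynomial (Fin p) ℂ}
    (hf : IsEllipticOnOctant f) : ∃ ℓ, IsLogBranch f ℓ := by
  have hne : ∀ x, evalReal f (octantProj x) ≠ 0 := fun x => hf.evalReal_ne_zero (octantProj_mem x)
  obtain ⟨F, ⟨-, hF⟩, -⟩ := Complex.isCoveringMapOn_exp.existsUnique_continuousMap_lifts
    (⟨fun x => evalReal f (octantProj x), (continuous_evalReal f).comp continuous_octantProj⟩ :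
      C(Fin p → ℝ, ℂ)) (a₀ := 0) (e₀ := Complex.log (evalReal f (octantProj 0)))
    (Complex.exp_log (hne 0)) hne
  refine ⟨F, F.continuous.continuousOn, fun x hx => ?_⟩
  have := congrFun hF x
  simpa [octantProj_eq hx] using this

theorem IsLogBranch.shift {p : ℕ} {f : MvPolynomial (Fin p) ℂ} {ℓ : (Fin p → ℝ) → ℂ}
    (h : IsLogBranch f ℓ) {a : Fin p → ℝ} (ha : a ∈ octant p) :
    IsLogBranch (shiftPoly a f) fun x => ℓ (a + x) := by
  refine ⟨h.continuousOn.comp (by fun_prop) fun x hx => add_mem_octant ha hx, fun x hx => ?_⟩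
  rw [evalReal_shiftPoly]
  exact h.exp_eq _ (add_mem_octant ha hx)

/-- Makes the branch continuous on all of ℝ^p without changing it on the octant, so that
measurability of the integrands is immediate. -/
theorem IsLogBranch.comp_octantProj {p : ℕ} {f : MvPolynomial (Fin p) ℂ} {ℓ : (Fin p → ℝ) → ℂ}
    (h : IsLogBranch f ℓ) :
    IsLogBranch f (fun x => ℓ (octantProj x)) ∧ Continuous (fun x => ℓ (octantProj x)) := by
  have hc : Continuous (fun x => ℓ (octantProj x)) :=
    h.continuousOn.comp_continuous continuous_octantProj octantProj_mem
  refine ⟨⟨hc.continuousOn, fun x hx => ?_⟩, hc⟩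
  rw [octantProj_eq hx]
  exact h.exp_eq x hx

/-- Along `[0, 1]` the argument of a polynomial without zeros on `[0, ∞)` varies by at most
`π` times the degree. -/
theorem abs_im_log_variation_le (q : Polynomial ℂ) (hq : ∀ τ : ℝ, 0 ≤ τ → q.eval (τ : ℂ) ≠ 0)
    (μ : ℝ → ℂ) (hμ : ContinuousOn μ (Set.Icc 0 1))
    (he : ∀ τ ∈ Set.Icc (0 : ℝ) 1, Complex.exp (μ τ) = q.eval (τ : ℂ)) :
    |(μ 1 - μ 0).im| ≤ q.natDegree * Real.pi := by
  have hs : q.Splits := IsAlgClosed.splits q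
  have hq0 : q ≠ 0 := fun h => hq 0 le_rfl (by simp [h])
  -- If 1 - τ/r were real and non-positive, r would be a positive real root of q.
  have hroot : ∀ r ∈ q.roots, ∀ τ : ℝ, 0 ≤ τ → (1 - τ / r : ℂ) ∈ Complex.slitPlane := by
    intro r hr τ hτ
    have hr0 : r ≠ 0 := by
      rintro rfl
      exact hq 0 le_rfl (by simpa using (Polynomial.mem_roots hq0).1 hr)
    rw [Complex.mem_slitPlane_iff_not_le_zero]
    intro hle
    obtain ⟨y, hy, hy'⟩ : ∃ y : ℝ, 0 < y ∧ (τ / r : ℂ) = y := by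
      rw [Complex.le_def] at hle
      simp only [Complex.sub_re, Complex.one_re, Complex.zero_re, Complex.sub_im, Complex.one_im,
        Complex.zero_im] at hle
      refine ⟨(τ / r : ℂ).re, by linarith, Complex.ext (by simp) ?_⟩
      rw [Complex.ofReal_im]
      linarith
    rw [div_eq_iff hr0] at hy'
    have hreal : r = ((τ / y : ℝ) : ℂ) := by
      have : (y : ℂ) ≠ 0 := by exact_mod_cast hy.ne'
      push_cast
      rw [hy']; field_simp
    refine hq (τ / y) (by positivity) ?_
    rw [← hreal]
    exact (Polynomial.mem_roots hq0).1 hr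
  -- Since q(τ) = q(0) ∏ (1 - τ/r) and no factor meets the cut, the sum of principal logarithms is a
  -- continuous logarithm of q(τ)/q(0). Each root contributes at most π to its imaginary part.
  set Λ : ℝ → ℂ := fun τ => (q.roots.map fun r => Complex.log (1 - τ / r)).sum with hΛ
  have hΛc : ContinuousOn Λ (Set.Icc 0 1) := by
    intro τ hτ
    refine ContinuousAt.continuousWithinAt ?_
    refine tendsto_multiset_sum _ fun r hr => ?_
    exact ContinuousAt.clog (by fun_prop) (hroot r hr τ hτ.1)
  have hΛe : ∀ τ ∈ Set.Icc (0 : ℝ) 1, Complex.exp (Λ τ + μ 0) = q.eval (τ : ℂ) := by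
    intro τ hτ
    have h0 : Complex.exp (μ 0) = q.eval ((0 : ℝ) : ℂ) := he 0 (by simp)
    rw [Complex.exp_add, h0, hΛ, Complex.exp_multiset_sum, Multiset.map_map]
    rw [hs.eval_eq_prod_roots, hs.eval_eq_prod_roots, mul_left_comm, ← Multiset.prod_map_mul]
    congr 2
    refine Multiset.map_congr rfl fun r hr => ?_
    have hr0 : r ≠ 0 := by
      rintro rfl
      exact hq 0 le_rfl (by simpa using (Polynomial.mem_roots hq0).1 hr)
    rw [Function.comp_apply, Complex.exp_log (Complex.slitPlane_ne_zero (hroot r hr τ hτ.1))]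
    field_simp
    push_cast
    ring
  obtain ⟨k, hk⟩ := exists_int_eq_add_of_exp_eq isPreconnected_Icc hμ
    (hΛc.add continuousOn_const) fun τ hτ => (he τ hτ).trans (hΛe τ hτ).symm
  have h0 := hk 0 (by simp)
  have h1 := hk 1 (by simp)
  have hΛ0 : Λ 0 = 0 := by simp [hΛ]
  have hdiff : μ 1 - μ 0 = Λ 1 := by
    simp only [Pi.add_apply, hΛ0] at h0 h1
    linear_combination h1 - h0
  rw [hdiff, hΛ]
  have : ∀ s : Multiset ℂ, |((s.map fun r => Complex.log (1 - (1 : ℝ) / r)).sum).im| ≤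
      Multiset.card s * Real.pi := by
    intro s
    induction s using Multiset.induction_on with
    | empty => simp
    | cons a s ih =>
      rw [Multiset.map_cons, Multiset.sum_cons, Complex.add_im, Multiset.card_cons]
      push_cast
      have := Complex.abs_arg_le_pi (1 - (1 : ℝ) / a)
      rw [← Complex.log_im] at this
      push_cast at this ih
      refine (abs_add_le _ _).trans ?_
      linarith
  refine (this _).trans ?_
  gcongr
  exact Polynomial.card_roots' q

/-- The restriction of a polynomial to a line, as a polynomial in one variable. -/
theorem exists_polynomial_on_ray {p : ℕ} (f : MvPolynomial (Fin p) ℂ) (x : Fin p → ℝ) :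
    ∃ q : Polynomial ℂ, q.natDegree ≤ f.totalDegree ∧
      ∀ τ : ℝ, q.eval (τ : ℂ) = evalReal f (τ • x) := by
  refine ⟨MvPolynomial.aeval (fun i => Polynomial.C (x i : ℂ) * Polynomial.X) f, ?_, fun τ => ?_⟩
  · rw [f.as_sum, map_sum]
    refine Polynomial.natDegree_sum_le_of_forall_le _ _ fun L hL => ?_
    rw [← f.as_sum, MvPolynomial.aeval_monomial, Finsupp.prod_fintype _ _ (by simp)]
    refine (Polynomial.natDegree_C_mul_le _ _).trans ?_
    refine (Polynomial.natDegree_prod_le _ _).trans ?_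
    have : L.degree ≤ f.totalDegree := by
      exact_mod_cast mem_degLE_totalDegree (g := f) L (MvPolynomial.mem_support_iff.1 hL)
    rw [Finsupp.degree_eq_sum] at this
    refine le_trans (Finset.sum_le_sum fun i _ => ?_) this
    refine Polynomial.natDegree_pow_le.trans ?_
    calc _ ≤ L i * 1 := Nat.mul_le_mul_left _ ((Polynomial.natDegree_C_mul_le _ _).trans
        Polynomial.natDegree_X_le)
      _ = L i := mul_one _
  · rw [evalReal, ← Polynomial.coe_evalRingHom, MvPolynomial.eval, MvPolynomial.aeval_def,
      MvPolynomial.hom_eval₂]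
    simp only [MvPolynomial.coe_eval₂Hom]
    congr 1
    · ext z
      exact Polynomial.eval_C
    · funext i
      simp only [Polynomial.coe_evalRingHom, Polynomial.eval_mul, Polynomial.eval_C,
        Polynomial.eval_X, Pi.smul_apply, smul_eq_mul, Complex.ofReal_mul]
      exact mul_comm _ _

/-- Along the ray from 0 to `x` the variation is bounded through the degree alone, hence uniformly
in `x`. For non-real s the size of f^(-s) depends on this imaginary part. -/
theorem IsLogBranch.exists_abs_im_le {p : ℕ} {f : MvPolynomial (Fin p) ℂ} {ℓ : (Fin p → ℝ) → ℂ}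
    (h : IsLogBranch f ℓ) : ∃ B : ℝ, ∀ x ∈ octant p, |(ℓ x).im| ≤ B := by
  refine ⟨|(ℓ 0).im| + f.totalDegree * Real.pi, fun x hx => ?_⟩
  obtain ⟨q, hq, hqe⟩ := exists_polynomial_on_ray f x
  have := abs_im_log_variation_le q
    (fun τ hτ => by
      rw [hqe, ← h.exp_eq _ (smul_mem_octant hx hτ)]; exact Complex.exp_ne_zero _)
    (fun τ => ℓ (τ • x)) (h.continuousOn.comp (by fun_prop) fun τ hτ => smul_mem_octant hx hτ.1)
    (fun τ hτ => by rw [hqe]; exact h.exp_eq _ (smul_mem_octant hx hτ.1))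
  rw [one_smul, zero_smul, Complex.sub_im] at this
  have h2 : (q.natDegree : ℝ) * Real.pi ≤ f.totalDegree * Real.pi := by gcongr
  have h3 := abs_add_le ((ℓ x).im - (ℓ 0).im) (ℓ 0).im
  rw [sub_add_cancel] at h3
  linarith

/-- A continuous logarithm of a differentiable function is differentiable. -/
theorem hasDerivWithinAt_of_exp_eq {S : Set ℝ} {μ φ : ℝ → ℂ} {φ' : ℂ} {τ : ℝ} (hτ : τ ∈ S)
    (hμ : ContinuousWithinAt μ S τ) (he : ∀ σ ∈ S, Complex.exp (μ σ) = φ σ)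
    (hφ : HasDerivWithinAt φ φ' S τ) : HasDerivWithinAt μ (φ' / φ τ) S τ := by
  have hne : φ τ ≠ 0 := by rw [← he τ hτ]; exact Complex.exp_ne_zero _
  -- Near τ, μ agrees with the principal logarithm of φ(σ)/φ(τ) plus μ(τ), because by continuity
  -- μ(σ) - μ(τ) has imaginary part less than π in absolute value.
  have hd : HasDerivWithinAt (fun σ => Complex.log (φ σ / φ τ) + μ τ) (φ' / φ τ) S τ := by
    have h1 : HasDerivWithinAt (fun σ => φ σ / φ τ) (φ' / φ τ) S τ := hφ.div_const _
    have h2 := h1.clog_real (by rw [div_self hne]; exact Complex.one_mem_slitPlane)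
    rw [div_self hne, div_one] at h2
    exact h2.add_const _
  have hclose : ∀ᶠ σ in nhdsWithin τ S, |(μ σ - μ τ).im| < Real.pi := by
    have : Filter.Tendsto (fun σ => |(μ σ - μ τ).im|) (nhdsWithin τ S) (nhds 0) := by
      have h3 : ContinuousWithinAt (fun σ => |(μ σ - μ τ).im|) S τ :=
        (Complex.continuous_im.continuousAt.comp_continuousWithinAt
          (hμ.sub continuousWithinAt_const)).abs
      simpa [ContinuousWithinAt] using h3
    exact this.eventually (gt_mem_nhds Real.pi_pos)
  refine hd.congr_of_eventuallyEq ?_ (by simp [div_self hne])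
  filter_upwards [hclose, self_mem_nhdsWithin] with σ hσ hσS
  rw [← he σ hσS, ← he τ hτ, ← Complex.exp_sub, Complex.log_exp]
  · ring
  · exact (abs_lt.1 hσ).1
  · exact (abs_lt.1 hσ).2.le

theorem IsLogBranch.hasDerivWithinAt_line {p : ℕ} {f : MvPolynomial (Fin p) ℂ}
    {ℓ : (Fin p → ℝ) → ℂ} (h : IsLogBranch f ℓ) {x t : Fin p → ℝ} (hx : x ∈ octant p)
    (ht : t ∈ octant p) {τ : ℝ} (hτ : 0 ≤ τ) :
    HasDerivWithinAt (fun τ : ℝ => ℓ (x + τ • t))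
      ((∑ i, (t i : ℂ) * evalReal (MvPolynomial.pderiv i f) (x + τ • t)) / evalReal f (x + τ • t))
      (Set.Ici 0) τ := by
  have hmem : ∀ σ ∈ Set.Ici (0 : ℝ), x + σ • t ∈ octant p :=
    fun σ hσ => add_mem_octant hx (smul_mem_octant ht hσ)
  exact hasDerivWithinAt_of_exp_eq (S := Set.Ici 0) (φ := fun τ => evalReal f (x + τ • t)) hτ
    ((h.continuousOn.comp (by fun_prop) hmem) τ hτ) (fun σ hσ => h.exp_eq _ (hmem σ hσ))
    (evalReal_hasDerivAt_line f x t τ).hasDerivWithinAt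

end LogBranch

/-! ### Formal symbols and their order -/

/-- Formal symbols: `u` stands for `∑ n, (s)_n u_n f^{-s-n}`, with `(s)_n = s(s+1)⋯(s+n-1)`. -/
abbrev FormalSymbol (p : ℕ) := ℕ →₀ MvPolynomial (Fin p) ℂ

namespace FormalSymbol

section Basic

variable {p : ℕ}

/-- The value of a symbol at `s ∈ ℂ` and `x ∈ ℝ^p`, formed with the branch `ℓ` of `log f`. -/
noncomputable def eval (ℓ : (Fin p → ℝ) → ℂ) (s : ℂ) (x : Fin p → ℝ) : FormalSymbol p →ₗ[ℂ] ℂ :=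
  Finsupp.lsum ℂ fun n => ((ascPochhammer ℂ n).eval s * Complex.exp (-(s + n) * ℓ x)) •
    (MvPolynomial.aeval fun i => (x i : ℂ)).toLinearMap

theorem eval_single (ℓ : (Fin p → ℝ) → ℂ) (s : ℂ) (x : Fin p → ℝ) (n : ℕ)
    (g : MvPolynomial (Fin p) ℂ) :
    eval ℓ s x (Finsupp.single n g) =
      (ascPochhammer ℂ n).eval s * Complex.exp (-(s + n) * ℓ x) * evalReal g x := by
  simp [eval, evalReal]

theorem eval_single_zero (ℓ : (Fin p → ℝ) → ℂ) (s : ℂ) (x : Fin p → ℝ)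
    (g : MvPolynomial (Fin p) ℂ) :
    eval ℓ s x (Finsupp.single 0 g) = zetaTerm g ℓ s x := by
  rw [eval_single]
  simp [zetaTerm, mul_comm]

/-- The symbols of order at most `m`, for polynomials `f` of degree `d`. -/
noncomputable def ofOrder (d : ℕ) (m : ℤ) : Submodule ℂ (FormalSymbol p) where
  carrier := {u | ∀ n : ℕ, u n ∈ degLE (m + n * d)}
  zero_mem' := fun _ => zero_mem _
  add_mem' := fun ha hb n => add_mem (ha n) (hb n)
  smul_mem' := fun c _ ha n => Submodule.smul_mem _ c (ha n)

variable {d : ℕ} {m : ℤ}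

theorem single_mem_ofOrder {n : ℕ} {g : MvPolynomial (Fin p) ℂ} (hg : g ∈ degLE (m + n * d)) :
    (Finsupp.single n g : FormalSymbol p) ∈ ofOrder d m := by
  intro k
  rw [Finsupp.single_apply]
  split_ifs with h
  · rwa [← h]
  · exact zero_mem _

theorem ofOrder_mono {m' : ℤ} (h : m ≤ m') {u : FormalSymbol p} (hu : u ∈ ofOrder d m) :
    u ∈ ofOrder d m' := fun n => degLE_mono (by omega) (hu n)

theorem ofOrder_induction {P : FormalSymbol p → Prop} (zero : P 0)
    (add : ∀ a b, P a → P b → P (a + b))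
    (single : ∀ (n : ℕ) g, g ∈ degLE (m + n * d) → P (Finsupp.single n g))
    {u : FormalSymbol p} (hu : u ∈ ofOrder d m) : P u := by
  rw [← u.sum_single]
  exact Finset.sum_induction _ P add zero fun n _ => single n _ (hu n)

theorem differentiable_eval (ℓ : (Fin p → ℝ) → ℂ) (x : Fin p → ℝ) (u : FormalSymbol p) :
    Differentiable ℂ fun s => eval ℓ s x u := by
  induction u using Finsupp.induction_linear with
  | zero => simp
  | add a b ha hb => simpa only [map_add] using ha.fun_add hb
  | single n g =>
    simp only [eval_single]
    exact ((Polynomial.differentiable _).mul (by fun_prop)).mul_const _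

theorem continuous_eval {ℓ : (Fin p → ℝ) → ℂ} (hℓ : Continuous ℓ) (s : ℂ) (u : FormalSymbol p) :
    Continuous fun x => eval ℓ s x u := by
  induction u using Finsupp.induction_linear with
  | zero => simpa using continuous_const
  | add a b ha hb =>
    simp only [map_add]
    exact ha.add hb
  | single n g =>
    simp only [eval_single]
    exact (continuous_const.mul (by fun_prop)).mul (continuous_evalReal g)

/-- Terms with `n > N` die because (-N)_n = 0; in the others the degree bound `m + n * d` is
negative, so the polynomial is zero. Both the absence of poles at -N and the polynomiality in the
shift rest on this. -/
theorem eval_neg_natCast_eq_zero {N : ℕ} (hm : m + N * d < 0) {u : FormalSymbol p}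
    (hu : u ∈ ofOrder d m) (ℓ : (Fin p → ℝ) → ℂ) (x : Fin p → ℝ) : eval ℓ (-(N : ℂ)) x u = 0 := by
  refine ofOrder_induction (P := fun u => eval ℓ (-(N : ℂ)) x u = 0) (map_zero _) ?_ ?_ hu
  · intro a b ha hb
    rw [map_add, ha, hb, add_zero]
  · intro n g hg
    rw [eval_single]
    rcases lt_or_ge N n with h | h
    · rw [ascPochhammer_eval_neg_coe_nat_of_lt h, zero_mul, zero_mul]
    · have hlt : m + n * d < 0 := by
        have : (n : ℤ) * d ≤ N * d := by gcongr
        omega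
      rw [eq_zero_of_mem_degLE hlt hg]
      simp [evalReal]

/-- The derivative `∂_i` on symbols. -/
noncomputable def deriv (f : MvPolynomial (Fin p) ℂ) (i : Fin p) :
    FormalSymbol p →ₗ[ℂ] FormalSymbol p :=
  Finsupp.lsum ℂ fun n => Finsupp.lsingle n ∘ₗ (MvPolynomial.pderiv i).toLinearMap -
    Finsupp.lsingle (n + 1) ∘ₗ LinearMap.mulRight ℂ (MvPolynomial.pderiv i f)

/-- Differentiating f^(-s-n) produces the factor -(s + n), which turns (s)_n into -(s)_(n+1). So `s`
does not appear in the operator. -/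
theorem deriv_single (f : MvPolynomial (Fin p) ℂ) (i : Fin p) (n : ℕ)
    (g : MvPolynomial (Fin p) ℂ) :
    deriv f i (Finsupp.single n g) = Finsupp.single n (MvPolynomial.pderiv i g) -
      Finsupp.single (n + 1) (g * MvPolynomial.pderiv i f) := by
  simp [deriv]

/-- Passing from `n` to `n + 1` allows `d` more degrees, of which multiplication by ∂_i f uses only
`d - 1`. -/
theorem deriv_mem_ofOrder {f : MvPolynomial (Fin p) ℂ} (i : Fin p) {u : FormalSymbol p}
    (hu : u ∈ ofOrder f.totalDegree m) : deriv f i u ∈ ofOrder f.totalDegree (m - 1) := by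
  refine ofOrder_induction (P := fun u => deriv f i u ∈ ofOrder f.totalDegree (m - 1))
    (by simp) ?_ ?_ hu
  · intro a b ha hb
    rw [map_add]
    exact add_mem ha hb
  · intro n g hg
    rw [deriv_single]
    refine sub_mem (single_mem_ofOrder (degLE_mono ?_ (pderiv_mem_degLE i hg)))
      (single_mem_ofOrder (degLE_mono ?_ (mul_mem_degLE hg
        (pderiv_mem_degLE i mem_degLE_totalDegree))))
    · omega
    · push_cast; linarith

/-- The iterated derivative along a word. -/
noncomputable def iterDeriv (f : MvPolynomial (Fin p) ℂ) :
    List (Fin p) → FormalSymbol p → FormalSymbol p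
  | [], u => u
  | i :: w, u => deriv f i (iterDeriv f w u)

theorem iterDeriv_mem_ofOrder {f : MvPolynomial (Fin p) ℂ} (w : List (Fin p)) {u : FormalSymbol p}
    (hu : u ∈ ofOrder f.totalDegree m) :
    iterDeriv f w u ∈ ofOrder f.totalDegree (m - w.length) := by
  induction w with
  | nil => simpa [iterDeriv] using hu
  | cons i w ih =>
    refine ofOrder_mono ?_ (deriv_mem_ofOrder i ih)
    simp only [List.length_cons]
    push_cast
    linarith

/-- The operator `m - s d - ∑ x_i ∂_i` on symbols of order `m`. -/
noncomputable def euler (f : MvPolynomial (Fin p) ℂ) (m : ℤ) :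
    FormalSymbol p →ₗ[ℂ] FormalSymbol p :=
  Finsupp.lsum ℂ fun n =>
    Finsupp.lsingle n ∘ₗ (((m + n * f.totalDegree : ℤ) : ℂ) • LinearMap.id - eulerOp) -
    Finsupp.lsingle (n + 1) ∘ₗ LinearMap.mulRight ℂ ((f.totalDegree : ℂ) • f - eulerOp f)

theorem euler_single (f : MvPolynomial (Fin p) ℂ) (n : ℕ) (g : MvPolynomial (Fin p) ℂ) :
    euler f m (Finsupp.single n g) =
      Finsupp.single n (((m + n * f.totalDegree : ℤ) : ℂ) • g - eulerOp g) -
      Finsupp.single (n + 1) (g * ((f.totalDegree : ℂ) • f - eulerOp f)) := by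
  simp only [euler, Finsupp.lsum_single, LinearMap.sub_apply, LinearMap.comp_apply,
    LinearMap.smul_apply, LinearMap.id_apply, Finsupp.lsingle_apply, LinearMap.mulRight_apply]

/-- In both terms the leading degree cancels, for `g` and for `f` respectively, by
`smul_sub_eulerOp_mem`. -/
theorem euler_mem_ofOrder {f : MvPolynomial (Fin p) ℂ} {u : FormalSymbol p}
    (hu : u ∈ ofOrder f.totalDegree m) : euler f m u ∈ ofOrder f.totalDegree (m - 1) := by
  refine ofOrder_induction (P := fun u => euler f m u ∈ ofOrder f.totalDegree (m - 1))
    (by simp) ?_ ?_ hu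
  · intro a b ha hb
    rw [map_add]
    exact add_mem ha hb
  · intro n g hg
    rw [euler_single]
    have h := smul_sub_eulerOp_mem (mem_degLE_totalDegree (g := f))
    rw [Int.cast_natCast] at h
    refine sub_mem (single_mem_ofOrder (degLE_mono ?_ (smul_sub_eulerOp_mem hg)))
      (single_mem_ofOrder (degLE_mono ?_ (mul_mem_degLE hg h)))
    · omega
    · push_cast; linarith

end Basic

/-! ### Symbols as functions: derivatives and growth -/

section Analytic

variable {p : ℕ} {f : MvPolynomial (Fin p) ℂ} {ℓ : (Fin p → ℝ) → ℂ} {m : ℤ}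

theorem exp_succ_mul_eq (hℓ : IsLogBranch f ℓ) (s : ℂ) (n : ℕ) {x : Fin p → ℝ}
    (hx : x ∈ octant p) :
    Complex.exp (-(s + ((n + 1 : ℕ) : ℂ)) * ℓ x) * evalReal f x =
      Complex.exp (-(s + n) * ℓ x) := by
  rw [← hℓ.exp_eq x hx, ← Complex.exp_add]
  congr 1
  push_cast
  ring

/-- Write m - sd = (m + nd) - (s + n)d. The second part is absorbed into index `n + 1` by (s)_n (s +
n) f^(-s-n) = (s)_(n+1) f · f^(-s-n-1). -/
theorem eval_euler (hℓ : IsLogBranch f ℓ) (s : ℂ) {x : Fin p → ℝ} (hx : x ∈ octant p)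
    (u : FormalSymbol p) :
    eval ℓ s x (euler f m u) =
      (m - s * f.totalDegree) * eval ℓ s x u - ∑ i, (x i : ℂ) * eval ℓ s x (deriv f i u) := by
  induction u using Finsupp.induction_linear with
  | zero => simp
  | add a b ha hb =>
    simp only [map_add, ha, hb, mul_add, Finset.sum_add_distrib]
    ring
  | single n g =>
    have hE : ∀ h : MvPolynomial (Fin p) ℂ,
        evalReal (eulerOp h) x = ∑ i, (x i : ℂ) * evalReal (MvPolynomial.pderiv i h) x := by
      intro h
      simp [eulerOp_apply, evalReal]
    have hsum : ∑ i, (x i : ℂ) * eval ℓ s x (deriv f i (Finsupp.single n g)) =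
        (ascPochhammer ℂ n).eval s * Complex.exp (-(s + n) * ℓ x) * evalReal (eulerOp g) x -
        (ascPochhammer ℂ (n + 1)).eval s * Complex.exp (-(s + ((n + 1 : ℕ) : ℂ)) * ℓ x) *
          (evalReal g x * evalReal (eulerOp f) x) := by
      rw [hE, hE, Finset.mul_sum, Finset.mul_sum, Finset.mul_sum, ← Finset.sum_sub_distrib]
      refine Finset.sum_congr rfl fun i _ => ?_
      rw [deriv_single, map_sub, eval_single, eval_single]
      simp only [evalReal, map_mul]
      ring
    rw [hsum, euler_single, map_sub, eval_single, eval_single, eval_single,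
      ← exp_succ_mul_eq hℓ s n hx, ascPochhammer_succ_eval]
    simp only [evalReal, map_mul, map_sub, MvPolynomial.smul_eval]
    push_cast
    ring

theorem hasDerivWithinAt_eval (hℓ : IsLogBranch f ℓ) (s : ℂ) {x t : Fin p → ℝ}
    (hx : x ∈ octant p) (ht : t ∈ octant p) {τ : ℝ} (hτ : 0 ≤ τ) (u : FormalSymbol p) :
    HasDerivWithinAt (fun τ : ℝ => eval ℓ s (x + τ • t) u)
      (∑ i, (t i : ℂ) * eval ℓ s (x + τ • t) (deriv f i u)) (Set.Ici 0) τ := by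
  induction u using Finsupp.induction_linear with
  | zero => simpa using hasDerivWithinAt_const τ (Set.Ici (0 : ℝ)) (0 : ℂ)
  | add a b ha hb =>
    simp only [map_add, mul_add, Finset.sum_add_distrib]
    exact ha.add hb
  | single n g =>
    have hy : x + τ • t ∈ octant p := add_mem_octant hx (smul_mem_octant ht hτ)
    have h1 := (hℓ.hasDerivWithinAt_line hx ht hτ).const_mul (-(s + n))
    have h2 := (h1.cexp.const_mul ((ascPochhammer ℂ n).eval s)).mul
      (evalReal_hasDerivAt_line g x t τ).hasDerivWithinAt
    simp only [eval_single]
    refine h2.congr_deriv ?_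
    have hf0 : evalReal f (x + τ • t) ≠ 0 := by
      rw [← hℓ.exp_eq _ hy]; exact Complex.exp_ne_zero _
    have hsum : ∑ i, (t i : ℂ) * eval ℓ s (x + τ • t) (deriv f i (Finsupp.single n g)) =
        (ascPochhammer ℂ n).eval s * Complex.exp (-(s + n) * ℓ (x + τ • t)) *
          (∑ i, (t i : ℂ) * evalReal (MvPolynomial.pderiv i g) (x + τ • t)) -
        (ascPochhammer ℂ (n + 1)).eval s *
          Complex.exp (-(s + ((n + 1 : ℕ) : ℂ)) * ℓ (x + τ • t)) * evalReal g (x + τ • t) *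
          (∑ i, (t i : ℂ) * evalReal (MvPolynomial.pderiv i f) (x + τ • t)) := by
      rw [Finset.mul_sum, Finset.mul_sum, ← Finset.sum_sub_distrib]
      refine Finset.sum_congr rfl fun i _ => ?_
      rw [deriv_single, map_sub, eval_single, eval_single]
      simp only [evalReal, map_mul]
      ring
    rw [hsum, ← exp_succ_mul_eq hℓ s n hy, ascPochhammer_succ_eval]
    field_simp
    ring

theorem exists_log_bounds (hf : IsEllipticOnOctant f) (hℓ : IsLogBranch f ℓ) :
    ∃ A : ℝ, 0 ≤ A ∧ ∀ x ∈ octant p,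
      |(ℓ x).re - f.totalDegree * Real.log (1 + ‖x‖)| ≤ A ∧ |(ℓ x).im| ≤ A := by
  obtain ⟨c, hc, hlow⟩ := hf.lower_bound
  obtain ⟨C, hC, hup⟩ := norm_evalReal_le (mem_degLE_totalDegree (g := f))
  obtain ⟨B, hB⟩ := hℓ.exists_abs_im_le
  refine ⟨max |B| (max |Real.log c| |Real.log C|), by positivity, fun x hx => ⟨?_, ?_⟩⟩
  · have hpos : 0 < 1 + ‖x‖ := by positivity
    have hre : (ℓ x).re = Real.log ‖evalReal f x‖ := by
      rw [← hℓ.exp_eq x hx, Complex.norm_exp, Real.log_exp]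
    have h1 := hlow x hx
    have h2 := hup x
    rw [Int.cast_natCast, Real.rpow_natCast] at h2
    have hn : 0 < ‖evalReal f x‖ := norm_pos_iff.2 (hf.evalReal_ne_zero hx)
    have hC0 : 0 < C := by
      by_contra h
      have : C * (1 + ‖x‖) ^ f.totalDegree ≤ 0 :=
        mul_nonpos_of_nonpos_of_nonneg (not_lt.1 h) (by positivity)
      linarith
    have l1 := Real.log_le_log (by positivity) h1
    have l2 := Real.log_le_log hn h2
    rw [Real.log_mul hc.ne' (by positivity), Real.log_pow] at l1
    rw [Real.log_mul hC0.ne' (by positivity), Real.log_pow] at l2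
    rw [hre, abs_le]
    have m1 := (le_max_left |Real.log c| |Real.log C|).trans (le_max_right |B| _)
    have m2 := (le_max_right |Real.log c| |Real.log C|).trans (le_max_right |B| _)
    have := neg_abs_le (Real.log c)
    have := le_abs_self (Real.log C)
    constructor <;> linarith
  · exact (hB x hx).trans ((le_abs_self B).trans (le_max_left _ _))

/-- The excess degree `n * d` of the n-th coefficient is compensated by the extra f^(-n), so all
terms have the same growth. Uniformity on bounded sets of `s` is what later gives holomorphy. -/
theorem norm_eval_le (hf : IsEllipticOnOctant f) (hℓ : IsLogBranch f ℓ) {u : FormalSymbol p}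
    (hu : u ∈ ofOrder f.totalDegree m) (S : ℝ) :
    ∃ C : ℝ, 0 ≤ C ∧ ∀ s : ℂ, ‖s‖ ≤ S → ∀ x ∈ octant p,
      ‖eval ℓ s x u‖ ≤ C * (1 + ‖x‖) ^ (m - f.totalDegree * s.re : ℝ) := by
  obtain ⟨A, hA, hlog⟩ := exists_log_bounds hf hℓ
  refine ofOrder_induction (P := fun u => ∃ C : ℝ, 0 ≤ C ∧ ∀ s : ℂ, ‖s‖ ≤ S → ∀ x ∈ octant p,
      ‖eval ℓ s x u‖ ≤ C * (1 + ‖x‖) ^ (m - f.totalDegree * s.re : ℝ)) ?_ ?_ ?_ hu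
  · exact ⟨0, le_rfl, by simp⟩
  · rintro a b ⟨C₁, h₁, ha⟩ ⟨C₂, h₂, hb⟩
    refine ⟨C₁ + C₂, add_nonneg h₁ h₂, fun s hs x hx => ?_⟩
    rw [map_add, add_mul]
    exact (norm_add_le _ _).trans (add_le_add (ha s hs x hx) (hb s hs x hx))
  · intro n g hg
    obtain ⟨G, hG, hgle⟩ := norm_evalReal_le hg
    obtain ⟨Q, hQ⟩ := (isCompact_closedBall (0 : ℂ) S).exists_bound_of_continuousOn
      (ascPochhammer ℂ n).continuous.continuousOn
    refine ⟨max Q 0 * Real.exp ((S + n) * A + S * A) * G, by positivity, fun s hs x hx => ?_⟩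
    have hpos : 0 < 1 + ‖x‖ := by positivity
    obtain ⟨hre, him⟩ := hlog x hx
    have e1 : ‖Complex.exp (-(s + n) * ℓ x)‖ ≤ Real.exp ((S + n) * A + S * A) *
        (1 + ‖x‖) ^ (-(s.re + n) * f.totalDegree : ℝ) := by
      rw [Complex.norm_exp, Real.rpow_def_of_pos hpos, ← Real.exp_add, Real.exp_le_exp]
      simp only [Complex.mul_re, Complex.neg_re, Complex.add_re, Complex.natCast_re,
        Complex.neg_im, Complex.add_im, Complex.natCast_im, add_zero]
      have hs1 : |s.re + n| ≤ S + n := by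
        refine (abs_add_le _ _).trans ?_
        rw [Nat.abs_cast]
        linarith [Complex.abs_re_le_norm s]
      have hs2 : |s.im| ≤ S := (Complex.abs_im_le_norm s).trans hs
      have hS : 0 ≤ S := (norm_nonneg s).trans hs
      have k1 : |s.re + n| * |(ℓ x).re - f.totalDegree * Real.log (1 + ‖x‖)| ≤ (S + n) * A := by
        gcongr
      have k2 : |s.im| * |(ℓ x).im| ≤ S * A := by gcongr
      rw [← abs_mul] at k1 k2
      have := neg_abs_le ((s.re + n) * ((ℓ x).re - f.totalDegree * Real.log (1 + ‖x‖)))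
      have := le_abs_self (s.im * (ℓ x).im)
      linarith
    have e2 : (1 + ‖x‖) ^ (m - f.totalDegree * s.re : ℝ) =
        (1 + ‖x‖) ^ (-(s.re + n) * f.totalDegree : ℝ) *
          (1 + ‖x‖) ^ ((m + n * f.totalDegree : ℤ) : ℝ) := by
      rw [← Real.rpow_add hpos]
      congr 1
      push_cast
      ring
    have e3 : ‖(ascPochhammer ℂ n).eval s‖ ≤ max Q 0 :=
      (hQ s (by simpa using hs)).trans (le_max_left _ _)
    rw [eval_single, norm_mul, norm_mul, e2]
    calc _ ≤ max Q 0 * (Real.exp ((S + n) * A + S * A) *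
          (1 + ‖x‖) ^ (-(s.re + n) * f.totalDegree : ℝ)) *
          (G * (1 + ‖x‖) ^ ((m + n * f.totalDegree : ℤ) : ℝ)) := by
          gcongr
          exact hgle x
      _ = _ := by ring

end Analytic

/-! ### Taylor's formula for symbols -/

section Taylor

/-- A Taylor estimate for a function given with all its derivatives. -/
theorem taylor_bound {φ : ℕ → ℝ → ℂ} {C : ℝ} (M : ℕ)
    (hφ : ∀ j, ∀ τ : ℝ, 0 ≤ τ → HasDerivWithinAt (φ j) (φ (j + 1) τ) (Set.Ici 0) τ)
    (hC : ∀ τ ∈ Set.Icc (0 : ℝ) 1, ‖φ M τ‖ ≤ C) :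
    ∀ τ ∈ Set.Icc (0 : ℝ) 1,
      ‖φ 0 τ - ∑ j ∈ Finset.range M, (τ : ℂ) ^ j / (j.factorial : ℂ) * φ j 0‖ ≤ C := by
  induction M generalizing φ with
  | zero => simpa using hC
  | succ M ih =>
    -- The derivative of the remainder of order `M + 1` of `φ 0` is the remainder of order `M` of `φ
    -- 1`; the mean value inequality on [0, 1] then keeps the constant.
    have ih' := ih (φ := fun j => φ (j + 1)) (fun j => hφ (j + 1)) hC
    set ρ : ℝ → ℂ := fun τ =>
      φ 0 τ - ∑ j ∈ Finset.range (M + 1), (τ : ℂ) ^ j / (j.factorial : ℂ) * φ j 0 with hρ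
    have hder : ∀ τ ∈ Set.Icc (0 : ℝ) 1, HasDerivWithinAt ρ (φ 1 τ -
        ∑ j ∈ Finset.range M, (τ : ℂ) ^ j / (j.factorial : ℂ) * φ (j + 1) 0) (Set.Icc 0 1) τ := by
      intro τ hτ
      refine ((hφ 0 τ hτ.1).mono Set.Icc_subset_Ici_self).sub ?_
      simp only [Finset.sum_range_succ' _ M, pow_zero]
      refine HasDerivWithinAt.add_const (𝕜 := ℝ) (F := ℂ) _
        (HasDerivWithinAt.fun_sum fun j _ => ?_)
      refine HasDerivWithinAt.mul_const ?_ _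
      have h1 : HasDerivAt (fun τ : ℝ => (τ : ℂ) ^ (j + 1)) (((j + 1 : ℕ) : ℂ) * (τ : ℂ) ^ j) τ := by
        have := (hasDerivAt_pow (j + 1) (τ : ℂ)).comp_ofReal
        simpa using this
      refine ((h1.div_const _).congr_deriv ?_).hasDerivWithinAt
      rw [Nat.factorial_succ]
      have : ((j + 1 : ℕ) : ℂ) ≠ 0 := Nat.cast_ne_zero.2 (Nat.succ_ne_zero j)
      push_cast at this ⊢
      field_simp
    have hρ0 : ρ 0 = 0 := by
      simp [hρ, Finset.sum_range_succ']
    intro τ hτ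
    have hC0 : 0 ≤ C := (norm_nonneg _).trans (hC 0 (by simp))
    have := Convex.norm_image_sub_le_of_norm_hasDerivWithin_le hder ih' (convex_Icc 0 1)
      (Set.left_mem_Icc.2 zero_le_one) hτ
    rw [hρ0, sub_zero, sub_zero, Real.norm_of_nonneg hτ.1] at this
    exact this.trans (mul_le_of_le_one_right hC0 hτ.2)

variable {p : ℕ}

/-- The coefficient `t_w / j!` of a word `w` of length `j` in Taylor's formula. -/
noncomputable def taylorCoeff (t : Fin p → ℝ) {j : ℕ} (w : Fin j → Fin p) : ℂ :=
  (∏ k, (t (w k) : ℂ)) / (j.factorial : ℂ)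

/-- The remainder of order `M` in Taylor's formula for a symbol. -/
noncomputable def taylorRem (f : MvPolynomial (Fin p) ℂ) (ℓ : (Fin p → ℝ) → ℂ)
    (u : FormalSymbol p) (M : ℕ) (s : ℂ) (x t : Fin p → ℝ) : ℂ :=
  eval ℓ s (x + t) u - ∑ j ∈ Finset.range M, ∑ w : Fin j → Fin p,
    taylorCoeff t w * eval ℓ s x (iterDeriv f (List.ofFn w) u)

theorem differentiable_taylorRem (f : MvPolynomial (Fin p) ℂ) (ℓ : (Fin p → ℝ) → ℂ)
    (u : FormalSymbol p) (M : ℕ) (x t : Fin p → ℝ) :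
    Differentiable ℂ fun s => taylorRem f ℓ u M s x t := by
  unfold taylorRem
  exact (differentiable_eval ℓ _ u).sub (Differentiable.fun_sum fun j _ =>
    Differentiable.fun_sum fun w _ => (differentiable_eval ℓ x _).const_mul _)

theorem continuous_taylorRem (f : MvPolynomial (Fin p) ℂ) {ℓ : (Fin p → ℝ) → ℂ}
    (hℓ : Continuous ℓ) (u : FormalSymbol p) (M : ℕ) (s : ℂ) :
    Continuous fun y : (Fin p → ℝ) × (Fin p → ℝ) => taylorRem f ℓ u M s y.1 y.2 := by
  unfold taylorRem taylorCoeff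
  refine ((continuous_eval hℓ s u).comp (continuous_fst.add continuous_snd)).sub
    (continuous_finsetSum _ fun j _ => continuous_finsetSum _ fun w _ => Continuous.mul (by fun_prop)
      ((continuous_eval hℓ s _).comp continuous_fst))

variable {f : MvPolynomial (Fin p) ℂ} {ℓ : (Fin p → ℝ) → ℂ} {m : ℤ}

theorem norm_taylorRem_le (hℓ : IsLogBranch f ℓ) (u : FormalSymbol p) (M : ℕ) (s : ℂ)
    {x t : Fin p → ℝ} (hx : x ∈ octant p) (ht : t ∈ octant p) {C : ℝ}
    (hC : ∀ y ∈ octant p, ‖x‖ ≤ ‖y‖ → ‖∑ w : Fin M → Fin p,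
      (∏ k, (t (w k) : ℂ)) * eval ℓ s y (iterDeriv f (List.ofFn w) u)‖ ≤ C) :
    ‖taylorRem f ℓ u M s x t‖ ≤ C := by
  have h := taylor_bound (φ := fun j τ => ∑ w : Fin j → Fin p,
    (∏ k, (t (w k) : ℂ)) * eval ℓ s (x + τ • t) (iterDeriv f (List.ofFn w) u)) (C := C) M ?_ ?_ 1
      (by simp)
  · simp only [one_smul, Complex.ofReal_one, one_pow, zero_smul, add_zero] at h
    convert h using 2
    unfold taylorRem taylorCoeff
    congr 1
    · simp [iterDeriv]
    · refine Finset.sum_congr rfl fun j _ => ?_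
      rw [Finset.mul_sum]
      exact Finset.sum_congr rfl fun w _ => by ring
  · intro j τ hτ
    have h1 : HasDerivWithinAt (fun τ : ℝ => ∑ w : Fin j → Fin p,
        (∏ k, (t (w k) : ℂ)) * eval ℓ s (x + τ • t) (iterDeriv f (List.ofFn w) u))
        (∑ w : Fin j → Fin p, (∏ k, (t (w k) : ℂ)) *
          ∑ i, (t i : ℂ) * eval ℓ s (x + τ • t) (deriv f i (iterDeriv f (List.ofFn w) u)))
        (Set.Ici 0) τ :=
      HasDerivWithinAt.fun_sum fun w _ => (hasDerivWithinAt_eval hℓ s hx ht hτ _).const_mul _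
    refine h1.congr_deriv ?_
    -- A word of length `j + 1` is a first letter, from the new derivative, followed by a word of
    -- length `j`.
    rw [← (Fin.consEquiv fun _ : Fin (j + 1) => Fin p).sum_comp, Fintype.sum_prod_type_right]
    refine Finset.sum_congr rfl fun w _ => ?_
    rw [Finset.mul_sum]
    refine Finset.sum_congr rfl fun i _ => ?_
    simp only [Fin.consEquiv_apply, Fin.prod_univ_succ, Fin.cons_zero, Fin.cons_succ,
      List.ofFn_succ, iterDeriv]
    ring
  · intro τ hτ
    have hτt := smul_mem_octant ht hτ.1
    exact hC _ (add_mem_octant hx hτt) (norm_le_norm_add_of_mem_octant hx hτt)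

/-- The M-th derivatives have order `m - M`. Since the exponent is non-positive and norms do not
decrease along the segment, their bound is worst at `x`. -/
theorem exists_norm_taylorRem_le (hf : IsEllipticOnOctant f) (hℓ : IsLogBranch f ℓ)
    {u : FormalSymbol p} (hu : u ∈ ofOrder f.totalDegree m) (M : ℕ) (S T : ℝ) :
    ∃ C : ℝ, 0 ≤ C ∧ ∀ s : ℂ, ‖s‖ ≤ S → (m - M - f.totalDegree * s.re : ℝ) ≤ 0 →
      ∀ x ∈ octant p, ∀ t ∈ octant p, ‖t‖ ≤ T →
        ‖taylorRem f ℓ u M s x t‖ ≤ C * (1 + ‖x‖) ^ (m - M - f.totalDegree * s.re : ℝ) := by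
  have hw : ∀ w : Fin M → Fin p, iterDeriv f (List.ofFn w) u ∈ ofOrder f.totalDegree (m - M) := by
    intro w
    have := iterDeriv_mem_ofOrder (List.ofFn w) hu
    rwa [List.length_ofFn] at this
  choose C hC0 hC using fun w => norm_eval_le hf hℓ (hw w) S
  refine ⟨∑ w, max T 0 ^ M * C w, Finset.sum_nonneg fun w _ => mul_nonneg (by positivity) (hC0 w),
    fun s hs hneg x hx t ht hT => norm_taylorRem_le hℓ u M s hx ht fun y hy hxy => ?_⟩
  rw [Finset.sum_mul]
  refine (norm_sum_le _ _).trans (Finset.sum_le_sum fun w _ => ?_)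
  rw [norm_mul, norm_prod, mul_assoc]
  have h1 : ∏ k, ‖(t (w k) : ℂ)‖ ≤ max T 0 ^ M := by
    calc ∏ k, ‖(t (w k) : ℂ)‖ ≤ ∏ _k : Fin M, max T 0 := by
          refine Finset.prod_le_prod (fun _ _ => norm_nonneg _) fun k _ => ?_
          rw [Complex.norm_real]
          exact ((norm_le_pi_norm t _).trans hT).trans (le_max_left _ _)
      _ = max T 0 ^ M := by simp
  gcongr
  refine (hC w s hs y hy).trans ?_
  push_cast
  refine mul_le_mul_of_nonneg_left ?_ (hC0 w)
  exact Real.rpow_le_rpow_of_nonpos (by positivity) (by linarith) hneg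

theorem taylorRem_neg_natCast_eq_zero (hℓ : IsLogBranch f ℓ) {u : FormalSymbol p}
    (hu : u ∈ ofOrder f.totalDegree m) {M N : ℕ} (hM : m - M + N * f.totalDegree < 0)
    {x t : Fin p → ℝ} (hx : x ∈ octant p) (ht : t ∈ octant p) :
    taylorRem f ℓ u M (-(N : ℂ)) x t = 0 := by
  rw [← norm_le_zero_iff]
  refine norm_taylorRem_le hℓ u M _ hx ht fun y _ _ => ?_
  rw [Finset.sum_eq_zero, norm_zero]
  intro w _
  have := iterDeriv_mem_ofOrder (List.ofFn w) hu
  rw [List.length_ofFn] at this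
  rw [eval_neg_natCast_eq_zero hM this, mul_zero]

end Taylor

end FormalSymbol

/-! ### Holomorphic parameter integrals -/

section HolomorphicIntegral

/-- An integral depending holomorphically on a parameter is holomorphic, if it is locally
dominated. -/
theorem differentiableAt_integral_of_dominated {Y : Type*} [MeasurableSpace Y] {ν : Measure Y}
    {G : ℂ → Y → ℂ} {s₀ : ℂ} {r : ℝ} (hr : 0 < r) (hG : ∀ y, Differentiable ℂ fun s => G s y)
    (hmeas : ∀ s, AEStronglyMeasurable (G s) ν) {B : Y → ℝ} (hB : Integrable B ν)
    (hle : ∀ᵐ y ∂ν, ∀ s ∈ Metric.ball s₀ r, ‖G s y‖ ≤ B y) :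
    DifferentiableAt ℂ (fun s => ∫ y, G s y ∂ν) s₀ := by
  -- The derivative is a pointwise limit of measurable difference quotients.
  have hmeas' : AEStronglyMeasurable (fun y => deriv (fun s => G s y) s₀) ν := by
    refine aestronglyMeasurable_of_tendsto_ae Filter.atTop
      (f := fun (n : ℕ) y => ((n + 1 : ℂ)⁻¹)⁻¹ • (G (s₀ + (n + 1 : ℂ)⁻¹) y - G s₀ y))
      (fun n => by simpa only [Pi.smul_def, Pi.sub_def] using
        ((hmeas (s₀ + (n + 1 : ℂ)⁻¹)).sub (hmeas s₀)).const_smul ((n + 1 : ℂ)⁻¹)⁻¹) (Filter.Eventually.of_forall fun y => ?_)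
    have h := (hG y s₀).hasDerivAt.tendsto_slope_zero
    refine h.comp (tendsto_nhdsWithin_iff.2 ⟨?_, Filter.Eventually.of_forall fun n => ?_⟩)
    · have := tendsto_one_div_add_atTop_nhds_zero_nat (𝕜 := ℂ)
      simpa only [one_div] using this
    · exact inv_ne_zero (by exact_mod_cast Nat.succ_ne_zero n)
  -- Cauchy's estimate on circles of radius r/3 around points of the ball of radius r/2; these
  -- circles stay in the ball of radius r, as 1/2 + 1/3 < 1.
  refine (hasDerivAt_integral_of_dominated_loc_of_deriv_le (F := G)
    (F' := fun s y => deriv (fun s => G s y) s) (bound := fun y => B y / (r / 3))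
    (Metric.ball_mem_nhds s₀ (half_pos hr)) (Filter.Eventually.of_forall hmeas) ?_ hmeas' ?_
    (hB.div_const _) ?_).2.differentiableAt
  · exact hB.mono' (hmeas s₀) (hle.mono fun y hy => hy s₀ (Metric.mem_ball_self hr))
  · filter_upwards [hle] with y hy s hs
    refine Complex.norm_deriv_le_of_forall_mem_sphere_norm_le (by positivity)
      (hG y).diffContOnCl fun z hz => hy z ?_
    rw [mem_sphere_iff_norm] at hz
    rw [mem_ball_iff_norm] at hs ⊢
    calc ‖z - s₀‖ = ‖(z - s) + (s - s₀)‖ := by rw [sub_add_sub_cancel]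
      _ ≤ ‖z - s‖ + ‖s - s₀‖ := norm_add_le _ _
      _ < r := by linarith
  · exact Filter.Eventually.of_forall fun y s _ => (hG y s).hasDerivAt

theorem isOpen_re_gt (b : ℝ) : IsOpen {s : ℂ | b < s.re} :=
  isOpen_lt continuous_const Complex.continuous_re

theorem analyticAt_of_differentiableAt_re_gt {F : ℂ → ℂ} {b : ℝ}
    (h : ∀ s : ℂ, b < s.re → DifferentiableAt ℂ F s) {s : ℂ} (hs : b < s.re) : AnalyticAt ℂ F s :=
  DifferentiableOn.analyticAt (s := {s : ℂ | b < s.re})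
    (fun z hz => (h z hz).differentiableWithinAt) ((isOpen_re_gt b).mem_nhds hs)

end HolomorphicIntegral

/-! ### Meromorphic continuation to half-planes -/

section Continuation

/-- `ψ` is a meromorphic function on the half-plane `Re s > b`, analytic outside of `P`, which
agrees with `φ` for `Re s > σ`. -/
structure ContinuesTo (P : Set ℂ) (b σ : ℝ) (φ ψ : ℂ → ℂ) : Prop where
  meromorphicAt : ∀ s : ℂ, b < s.re → MeromorphicAt ψ s
  analyticAt : ∀ s : ℂ, b < s.re → s ∉ P → AnalyticAt ℂ ψ s
  eq : ∀ s : ℂ, σ < s.re → ψ s = φ s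

variable {P P' : Set ℂ} {b b' σ σ' : ℝ} {φ φ' φ₁ φ₂ ψ ψ₁ ψ₂ : ℂ → ℂ}

/-- Identity theorem: the difference has infinite order at a point far to the right, hence
everywhere in the connected half-plane. -/
theorem eventuallyEq_of_meromorphicAt_re_gt (h₁ : ∀ s : ℂ, b < s.re → MeromorphicAt ψ₁ s)
    (h₂ : ∀ s : ℂ, b < s.re → MeromorphicAt ψ₂ s) (heq : ∀ s : ℂ, σ < s.re → ψ₁ s = ψ₂ s)
    {s : ℂ} (hs : b < s.re) : ψ₁ =ᶠ[nhdsWithin s {s}ᶜ] ψ₂ := by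
  have hm : MeromorphicOn (ψ₁ - ψ₂) {s : ℂ | b < s.re} := fun z hz => (h₁ z hz).sub (h₂ z hz)
  have hconn : IsPreconnected {s : ℂ | b < s.re} := (convex_halfSpace_re_gt b).isPreconnected
  have htop : meromorphicOrderAt (ψ₁ - ψ₂) s = ⊤ := by
    by_contra hne
    have hz : b < (((max b σ + 1 : ℝ) : ℂ)).re := by
      rw [Complex.ofReal_re]; linarith [le_max_left b σ]
    refine hm.meromorphicOrderAt_ne_top_of_isPreconnected hconn hs hz hne
      (meromorphicOrderAt_eq_top_iff.2 ?_)
    have ho : {s : ℂ | σ < s.re} ∈ nhds (((max b σ + 1 : ℝ) : ℂ)) :=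
      (isOpen_re_gt σ).mem_nhds (by
        rw [Set.mem_ofPred_eq, Complex.ofReal_re]; linarith [le_max_right b σ])
    filter_upwards [nhdsWithin_le_nhds ho] with w hw
    simp [heq w hw]
  filter_upwards [meromorphicOrderAt_eq_top_iff.1 htop] with w hw
  exact sub_eq_zero.1 hw

theorem eq_of_meromorphicAt_re_gt (h₁ : ∀ s : ℂ, b < s.re → MeromorphicAt ψ₁ s)
    (h₂ : ∀ s : ℂ, b < s.re → MeromorphicAt ψ₂ s) (heq : ∀ s : ℂ, σ < s.re → ψ₁ s = ψ₂ s)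
    {s : ℂ} (hs : b < s.re) (a₁ : AnalyticAt ℂ ψ₁ s) (a₂ : AnalyticAt ℂ ψ₂ s) : ψ₁ s = ψ₂ s :=
  ((a₁.meromorphicNFAt.eventuallyEq_nhdsNE_iff_eventuallyEq_nhds a₂.meromorphicNFAt).1
    (eventuallyEq_of_meromorphicAt_re_gt h₁ h₂ heq hs)).eq_of_nhds

theorem ContinuesTo.eq_of_eq_on (h₁ : ContinuesTo P b σ φ₁ ψ₁) (h₂ : ContinuesTo P b σ φ₂ ψ₂)
    (h : ∀ s : ℂ, σ < s.re → φ₁ s = φ₂ s) {s : ℂ} (hs : b < s.re) (hP : s ∉ P) : ψ₁ s = ψ₂ s :=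
  eq_of_meromorphicAt_re_gt h₁.meromorphicAt h₂.meromorphicAt
    (fun z hz => by rw [h₁.eq z hz, h₂.eq z hz, h z hz]) hs (h₁.analyticAt s hs hP)
    (h₂.analyticAt s hs hP)

theorem ContinuesTo.mono (h : ContinuesTo P b σ φ ψ) (hP : P ⊆ P') (hb : b ≤ b') (hσ : σ ≤ σ') :
    ContinuesTo P' b' σ' φ ψ where
  meromorphicAt s hs := h.meromorphicAt s (hb.trans_lt hs)
  analyticAt s hs hsP := h.analyticAt s (hb.trans_lt hs) fun h' => hsP (hP h')
  eq s hs := h.eq s (hσ.trans_lt hs)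

theorem ContinuesTo.of_differentiableAt (hφ : ∀ s : ℂ, b < s.re → DifferentiableAt ℂ φ s) :
    ContinuesTo P b σ φ φ where
  meromorphicAt _ hs := (analyticAt_of_differentiableAt_re_gt hφ hs).meromorphicAt
  analyticAt _ hs _ := analyticAt_of_differentiableAt_re_gt hφ hs
  eq _ _ := rfl

theorem ContinuesTo.congr (h : ContinuesTo P b σ φ ψ) (he : ∀ s : ℂ, σ < s.re → φ s = φ' s) :
    ContinuesTo P b σ φ' ψ :=
  ⟨h.meromorphicAt, h.analyticAt, fun s hs => (h.eq s hs).trans (he s hs)⟩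

theorem ContinuesTo.add (h₁ : ContinuesTo P b σ φ₁ ψ₁) (h₂ : ContinuesTo P b σ φ₂ ψ₂) :
    ContinuesTo P b σ (fun s => φ₁ s + φ₂ s) (fun s => ψ₁ s + ψ₂ s) where
  meromorphicAt s hs := (h₁.meromorphicAt s hs).add (h₂.meromorphicAt s hs)
  analyticAt s hs hP := (h₁.analyticAt s hs hP).add (h₂.analyticAt s hs hP)
  eq s hs := by rw [h₁.eq s hs, h₂.eq s hs]

theorem ContinuesTo.sub (h₁ : ContinuesTo P b σ φ₁ ψ₁) (h₂ : ContinuesTo P b σ φ₂ ψ₂) :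
    ContinuesTo P b σ (fun s => φ₁ s - φ₂ s) (fun s => ψ₁ s - ψ₂ s) where
  meromorphicAt s hs := (h₁.meromorphicAt s hs).sub (h₂.meromorphicAt s hs)
  analyticAt s hs hP := (h₁.analyticAt s hs hP).sub (h₂.analyticAt s hs hP)
  eq s hs := by rw [h₁.eq s hs, h₂.eq s hs]

theorem ContinuesTo.const_mul (c : ℂ) (h : ContinuesTo P b σ φ ψ) :
    ContinuesTo P b σ (fun s => c * φ s) (fun s => c * ψ s) where
  meromorphicAt s hs := (MeromorphicAt.const c s).mul (h.meromorphicAt s hs)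
  analyticAt s hs hP := analyticAt_const.mul (h.analyticAt s hs hP)
  eq s hs := by rw [h.eq s hs]

theorem ContinuesTo.sum {ι : Type*} (S : Finset ι) {φ ψ : ι → ℂ → ℂ}
    (h : ∀ i ∈ S, ContinuesTo P b σ (φ i) (ψ i)) :
    ContinuesTo P b σ (fun s => ∑ i ∈ S, φ i s) (fun s => ∑ i ∈ S, ψ i s) := by
  classical
  induction S using Finset.induction_on with
  | empty => exact .of_differentiableAt fun s _ => by simp
  | insert i S hi ih =>
    simp only [Finset.sum_insert hi]
    exact (h i (Finset.mem_insert_self i S)).add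
      (ih fun j hj => h j (Finset.mem_insert_of_mem hj))

/-- Division by a linear factor whose zero `s₀` is a point of `P` or a zero of the dividend. -/
theorem ContinuesTo.exists_div_linear {A d : ℂ} (hd : d ≠ 0) (h : ContinuesTo P b σ φ' ψ)
    (hφ : ∀ s : ℂ, σ < s.re → (A - s * d) * φ s = φ' s) (hσ : (A / d).re ≤ σ)
    (hP : A / d ∈ P ∨ ψ (A / d) = 0) : ∃ ψ', ContinuesTo P b σ φ ψ' := by
  set s₀ := A / d with hs₀
  have hA : ∀ s, A - s * d = -d * (s - s₀) := fun s => by rw [hs₀]; field_simp; ring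
  have hne : ∀ s : ℂ, σ < s.re → s - s₀ ≠ 0 := by
    intro s hs h0
    rw [sub_eq_zero.1 h0] at hs
    linarith
  by_cases hsP₀ : s₀ ∈ P
  · refine ⟨fun s => ψ s / (A - s * d), ⟨fun s hs => ?_, fun s hs hsP => ?_, fun s hs => ?_⟩⟩
    · exact (h.meromorphicAt s hs).fun_div (by fun_prop)
    · refine (h.analyticAt s hs hsP).fun_div (by fun_prop) ?_
      rw [hA]
      refine mul_ne_zero (neg_ne_zero.2 hd) (sub_ne_zero.2 ?_)
      rintro rfl
      exact hsP hsP₀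
    · rw [h.eq s hs, ← hφ s hs, hA, mul_div_cancel_left₀]
      exact mul_ne_zero (neg_ne_zero.2 hd) (hne s hs)
  -- Here the quotient must be analytic at s₀. As ψ(s₀) = 0, the divided slope is the quotient by s
  -- - s₀ with the right value filled in.
  · replace hP := hP.resolve_left hsP₀
    have hslope : ∀ s, s ≠ s₀ → dslope ψ s₀ =ᶠ[nhds s] fun z => ψ z / (z - s₀) := by
      intro s hs
      filter_upwards [dslope_eventuallyEq_slope_of_ne ψ hs] with z hz
      rw [hz, slope_def_field, hP, sub_zero]
    have hAn : ∀ s : ℂ, b < s.re → s ∉ P → AnalyticAt ℂ (dslope ψ s₀) s := by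
      intro s hs hsP
      rcases eq_or_ne s s₀ with rfl | hss
      · obtain ⟨U, hU, hUd⟩ := (h.analyticAt _ hs hsP).eventually_analyticAt.exists_mem
        refine DifferentiableOn.analyticAt (s := U) ?_ hU
        exact (Complex.differentiableOn_dslope hU).2
          fun z hz => (hUd z hz).differentiableAt.differentiableWithinAt
      · refine AnalyticAt.congr ?_ (hslope s hss).symm
        exact (h.analyticAt s hs hsP).fun_div (by fun_prop) (sub_ne_zero.2 hss)
    refine ⟨fun s => (-d)⁻¹ * dslope ψ s₀ s, ⟨fun s hs => ?_, fun s hs hsP => ?_, fun s hs => ?_⟩⟩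
    · refine (MeromorphicAt.const _ s).mul ?_
      rcases eq_or_ne s s₀ with rfl | hss
      · exact (hAn _ hs hsP₀).meromorphicAt
      · refine MeromorphicAt.congr ?_ ((hslope s hss).symm.filter_mono nhdsWithin_le_nhds)
        exact (h.meromorphicAt s hs).fun_div (by fun_prop)
    · exact analyticAt_const.mul (hAn s hs hsP)
    · have h1 := hne s hs
      rw [(hslope s (sub_ne_zero.1 h1)).eq_of_nhds, h.eq s hs, ← hφ s hs, hA]
      field_simp

/-- Continuations to all half-planes fit together. -/
theorem exists_isMeromorphicContinuation (hP : ∀ s ∈ P, s.re ≤ σ)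
    (h : ∀ b : ℝ, ∃ ψ, ContinuesTo P b σ φ ψ) :
    ∃ Ψ, IsMeromorphicContinuation σ φ Ψ ∧ ∀ s ∉ P, AnalyticAt ℂ Ψ s := by
  choose ψ hψ using h
  -- The value at s is taken from a continuation to Re z > Re s - 1. Passing to normal form makes
  -- values from different continuations agree, even at poles.
  set Ψ : ℂ → ℂ := fun s => toMeromorphicNFAt (ψ (s.re - 1)) s s with hΨ
  have hloc : ∀ s : ℂ, Ψ =ᶠ[nhds s] toMeromorphicNFOn (ψ (s.re - 1)) {z | s.re - 1 < z.re} := by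
    intro s
    filter_upwards [(isOpen_re_gt (s.re - 1)).mem_nhds (by simp : s.re - 1 < s.re)] with z hz
    rw [toMeromorphicNFOn_eq_toMeromorphicNFAt (U := {z : ℂ | s.re - 1 < z.re})
      (fun w hw => (hψ _).meromorphicAt w hw) hz]
    refine (toMeromorphicNFAt_eventuallyEq_nhds_congr ?_).eq_of_nhds
    refine eventuallyEq_of_meromorphicAt_re_gt (b := max (s.re - 1) (z.re - 1)) (σ := σ)
      (fun w hw => (hψ _).meromorphicAt w ((le_max_right _ _).trans_lt hw))
      (fun w hw => (hψ _).meromorphicAt w ((le_max_left _ _).trans_lt hw))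
      (fun w hw => by rw [(hψ _).eq w hw, (hψ _).eq w hw]) ?_
    exact max_lt hz (by simp)
  have hmem : ∀ s : ℂ, s.re - 1 < s.re := fun s => by simp
  have hNF : ∀ s, MeromorphicNFAt Ψ s := fun s =>
    (meromorphicNFAt_congr (hloc s)).2 (meromorphicNFOn_toMeromorphicNFOn _ _ (hmem s))
  have hval : ∀ s ∉ P, Ψ s = ψ (s.re - 1) s ∧ AnalyticAt ℂ Ψ s := by
    intro s hs
    have hA := (hψ (s.re - 1)).analyticAt s (hmem s) hs
    have hself := toMeromorphicNFAt_eq_self.2 hA.meromorphicNFAt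
    refine ⟨by simp only [hΨ, hself], ?_⟩
    refine AnalyticAt.congr ?_ (hloc s).symm
    refine AnalyticAt.congr ?_ (toMeromorphicNFOn_eq_toMeromorphicNFAt_on_nhds
      (fun w hw => (hψ _).meromorphicAt w hw) (hmem s)).symm
    rwa [hself]
  refine ⟨Ψ, ⟨fun s _ => hNF s, fun s hs => ?_⟩, fun s hs => (hval s hs).2⟩
  have hsP : s ∉ P := fun h' => (hP s h').not_gt hs
  rw [(hval s hsP).1, (hψ _).eq s hs]

theorem meromorphicContinuation_eq {Ψ : ℂ → ℂ} (h : IsMeromorphicContinuation σ φ Ψ) :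
    meromorphicContinuation σ φ = Ψ := by
  have hex : ∃ ψ, IsMeromorphicContinuation σ φ ψ := ⟨Ψ, h⟩
  rw [meromorphicContinuation, dif_pos hex]
  exact hex.choose_spec.unique h

end Continuation

/-! ### Lebesgue measure and the lattice points -/

/-- The counting measure of the lattice points `ℕ^p`. -/
noncomputable def latticeMeasure (p : ℕ) : Measure (Fin p → ℝ) :=
  (Measure.count : Measure (Fin p → ℕ)).map latticePoint

/-- A measure carried by the octant, of dimension at most `p` at infinity. -/
structure IsOctantMeasure {p : ℕ} (μ : Measure (Fin p → ℝ)) : Prop where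
  ae_mem : ∀ᵐ x ∂μ, x ∈ octant p
  integrable_rpow : ∀ r : ℝ, r < -p → Integrable (fun x => (1 + ‖x‖) ^ r) μ

section Measures

variable {p : ℕ}

theorem isOctantMeasure_volume : IsOctantMeasure (volume.restrict (octant p)) where
  ae_mem := ae_restrict_mem measurableSet_octant
  integrable_rpow r hr := by
    have h := integrable_one_add_norm (E := Fin p → ℝ) (μ := volume) (r := -r) (by simp; linarith)
    rw [neg_neg] at h
    exact h.integrableOn

theorem measurableEmbedding_latticePoint : MeasurableEmbedding (latticePoint (p := p)) := by
  refine MeasurableEmbedding.of_measurable_inverse (g := fun x i => ⌊x i⌋₊) ?_ ?_ ?_ ?_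
  · exact measurable_pi_lambda _ fun i => by unfold latticePoint; fun_prop
  · exact (Set.countable_range _).measurableSet
  · exact measurable_pi_lambda _ fun i => by fun_prop
  · intro k; simp [latticePoint]

instance : SFinite (latticeMeasure p) := by
  unfold latticeMeasure; infer_instance

theorem integrable_latticeMeasure_iff {E : Type*} [NormedAddCommGroup E] {F : (Fin p → ℝ) → E} :
    Integrable F (latticeMeasure p) ↔ Summable fun k : Fin p → ℕ => ‖F (latticePoint k)‖ := by
  rw [latticeMeasure, measurableEmbedding_latticePoint.integrable_map_iff, integrable_count_iff]
  rfl

theorem integral_latticeMeasure {F : (Fin p → ℝ) → ℂ} (hF : Integrable F (latticeMeasure p)) :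
    ∫ x, F x ∂latticeMeasure p = ∑' k : Fin p → ℕ, F (latticePoint k) := by
  rw [latticeMeasure, measurableEmbedding_latticePoint.integrable_map_iff] at hF
  change Integrable (fun k => F (latticePoint k)) _ at hF
  rw [latticeMeasure, measurableEmbedding_latticePoint.integral_map, integral_countable hF]
  simp [Measure.real]

/-- The half-open unit cube with lower corner `k`. -/
def latticeCell (k : Fin p → ℕ) : Set (Fin p → ℝ) :=
  Set.univ.pi fun i => Set.Ico (k i : ℝ) (k i + 1)

theorem mem_latticeCell_iff {k : Fin p → ℕ} {x : Fin p → ℝ} (hx : x ∈ octant p) :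
    x ∈ latticeCell k ↔ (fun i => ⌊x i⌋₊) = k := by
  simp only [latticeCell, Set.mem_univ_pi, Set.mem_Ico, funext_iff]
  exact forall_congr' fun i => (Nat.floor_eq_iff (hx i)).symm

theorem latticeCell_subset_octant (k : Fin p → ℕ) : latticeCell k ⊆ octant p :=
  fun _ hx i => (Nat.cast_nonneg (k i)).trans (hx i (Set.mem_univ i)).1

theorem iUnion_latticeCell : ⋃ k : Fin p → ℕ, latticeCell k = octant p := by
  refine Set.Subset.antisymm (Set.iUnion_subset latticeCell_subset_octant) fun x hx => ?_
  exact Set.mem_iUnion.2 ⟨_, (mem_latticeCell_iff hx).2 rfl⟩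

theorem measurableSet_latticeCell (k : Fin p → ℕ) : MeasurableSet (latticeCell k) :=
  MeasurableSet.univ_pi fun _ => measurableSet_Ico

theorem pairwise_disjoint_latticeCell :
    Pairwise (Function.onFun Disjoint (latticeCell (p := p))) := by
  intro k k' hkk'
  refine Set.disjoint_left.2 fun x hx hx' => hkk' ?_
  have hxo := latticeCell_subset_octant k hx
  rw [← (mem_latticeCell_iff hxo).1 hx, ← (mem_latticeCell_iff hxo).1 hx']

theorem setIntegral_latticeCell {E : Type*} [NormedAddCommGroup E] [NormedSpace ℝ E]
    (F : (Fin p → ℝ) → E) (k : Fin p → ℕ) :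
    ∫ x in latticeCell k, F x = ∫ t in Set.Icc (0 : Fin p → ℝ) 1, F (latticePoint k + t) := by
  rw [← (measurePreserving_add_left volume (latticePoint k)).setIntegral_preimage_emb
    (measurableEmbedding_addLeft _)]
  refine setIntegral_congr_set ?_
  have : (fun t => latticePoint k + t) ⁻¹' latticeCell k =
      Set.univ.pi fun i => Set.Ico ((0 : Fin p → ℝ) i) ((1 : Fin p → ℝ) i) := by
    ext t
    simp [latticeCell, latticePoint]
  rw [this]
  exact Measure.univ_pi_Ico_ae_eq_Icc

theorem hasSum_integral_latticePoint_add {E : Type*} [NormedAddCommGroup E] [NormedSpace ℝ E]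
    {F : (Fin p → ℝ) → E} (hF : IntegrableOn F (octant p)) :
    HasSum (fun k : Fin p → ℕ => ∫ t in Set.Icc (0 : Fin p → ℝ) 1, F (latticePoint k + t))
      (∫ x in octant p, F x) := by
  have := hasSum_integral_iUnion (μ := volume) (f := F) measurableSet_latticeCell
    pairwise_disjoint_latticeCell (by rwa [iUnion_latticeCell])
  rw [iUnion_latticeCell] at this
  simpa only [setIntegral_latticeCell] using this

theorem Icc_subset_octant : Set.Icc (0 : Fin p → ℝ) 1 ⊆ octant p := fun _ ht => ht.1

theorem norm_le_one_of_mem_Icc {t : Fin p → ℝ} (ht : t ∈ Set.Icc (0 : Fin p → ℝ) 1) : ‖t‖ ≤ 1 :=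
  (pi_norm_le_iff_of_nonneg zero_le_one).2 fun i => by
    rw [Real.norm_of_nonneg (ht.1 i)]; exact ht.2 i

/-- Integral comparison: on the unit cube at k one has 1 + ‖k + t‖ ≤ 2(1 + ‖k‖), and `r ≤ 0`, so
each term is at most 2^(-r) times an integral over a cell of the octant. -/
theorem isOctantMeasure_latticeMeasure : IsOctantMeasure (latticeMeasure p) where
  ae_mem := by
    rw [latticeMeasure, measurableEmbedding_latticePoint.ae_map_iff]
    exact Filter.Eventually.of_forall latticePoint_mem_octant
  integrable_rpow r hr := by
    rw [integrable_latticeMeasure_iff]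
    have hr0 : r ≤ 0 := by
      have : (0 : ℝ) ≤ p := Nat.cast_nonneg p
      linarith
    have hI : IntegrableOn (fun x : Fin p → ℝ => (1 + ‖x‖) ^ r) (octant p) :=
      isOctantMeasure_volume.integrable_rpow r hr
    have hsum := (hasSum_integral_latticePoint_add hI).summable.mul_left ((2 : ℝ) ^ (-r))
    refine Summable.of_nonneg_of_le (fun _ => norm_nonneg _) (fun k => ?_) hsum
    rw [Real.norm_of_nonneg (by positivity)]
    have hvol : volume.real (Set.Icc (0 : Fin p → ℝ) 1) = 1 := by
      simp [Measure.real, Real.volume_Icc_pi]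
    have hcont : Continuous fun t : Fin p → ℝ => (1 + ‖latticePoint k + t‖) ^ r := by
      refine Continuous.rpow_const (by fun_prop) fun t => Or.inl ?_
      positivity
    have hlow : (2 * (1 + ‖latticePoint k‖)) ^ r ≤
        ∫ t in Set.Icc (0 : Fin p → ℝ) 1, (1 + ‖latticePoint k + t‖) ^ r := by
      have h1 : ∫ _t in Set.Icc (0 : Fin p → ℝ) 1, (2 * (1 + ‖latticePoint k‖)) ^ r =
          (2 * (1 + ‖latticePoint k‖)) ^ r := by
        rw [setIntegral_const, hvol, one_smul]
      rw [← h1]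
      refine setIntegral_mono_on
        (continuous_const.continuousOn.integrableOn_compact isCompact_Icc) (hcont.continuousOn.integrableOn_compact isCompact_Icc)
        measurableSet_Icc fun t ht => ?_
      refine Real.rpow_le_rpow_of_nonpos (by positivity) ?_ hr0
      have h2 := norm_add_le (latticePoint k) t
      have h3 := norm_le_one_of_mem_Icc ht
      have h4 := norm_nonneg (latticePoint k)
      linarith
    calc (1 + ‖latticePoint k‖) ^ r = 2 ^ (-r) * (2 * (1 + ‖latticePoint k‖)) ^ r := by
          rw [Real.mul_rpow (by norm_num) (by positivity), ← mul_assoc, ← Real.rpow_add (by norm_num)]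
          simp
      _ ≤ _ := by gcongr

/-- The product of a measure on the octant and the unit cube. -/
noncomputable abbrev prodCube (μ : Measure (Fin p → ℝ)) : Measure ((Fin p → ℝ) × (Fin p → ℝ)) :=
  μ.prod (volume.restrict (Set.Icc 0 1))

theorem isFiniteMeasure_cube : IsFiniteMeasure (volume.restrict (Set.Icc (0 : Fin p → ℝ) 1)) :=
  isFiniteMeasure_restrict.2 isCompact_Icc.measure_lt_top.ne

variable {μ : Measure (Fin p → ℝ)}

theorem IsOctantMeasure.integrable_rpow_prodCube [SFinite μ] (hμ : IsOctantMeasure μ) (r : ℝ)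
    (hr : r < -p) : Integrable (fun y => (1 + ‖y.1‖) ^ r) (prodCube μ) :=
  haveI := isFiniteMeasure_cube (p := p)
  (hμ.integrable_rpow r hr).comp_fst _

theorem IsOctantMeasure.ae_prodCube [SFinite μ] (hμ : IsOctantMeasure μ) :
    ∀ᵐ y ∂prodCube μ, y.1 ∈ octant p ∧ y.2 ∈ Set.Icc (0 : Fin p → ℝ) 1 :=
  (Measure.quasiMeasurePreserving_fst.ae hμ.ae_mem).and
    (Measure.quasiMeasurePreserving_snd.ae (ae_restrict_mem measurableSet_Icc))

/-- Fubini's theorem for the decomposition of the octant into unit cubes. -/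
theorem integral_prodCube_latticeMeasure {F : (Fin p → ℝ) → ℂ} (hF : IntegrableOn F (octant p))
    (hF' : Integrable (fun y => F (y.1 + y.2)) (prodCube (latticeMeasure p))) :
    ∫ y, F (y.1 + y.2) ∂prodCube (latticeMeasure p) = ∫ x in octant p, F x := by
  rw [integral_prod _ hF', integral_latticeMeasure hF'.integral_prod_left]
  exact (hasSum_integral_latticePoint_add hF).tsum_eq

end Measures

/-! ### Convergence and holomorphy of symbol integrals -/

section Dominated

/-- Integrability and holomorphy of the integral of a function of order `e - d Re s`. -/
theorem integrable_and_differentiableAt_of_order {p d : ℕ} (hd : 0 < d) {Y : Type*}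
    [MeasurableSpace Y] {ν : Measure Y} {ρ : Y → (Fin p → ℝ)}
    (hρ : ∀ r : ℝ, r < -p → Integrable (fun y => (1 + ‖ρ y‖) ^ r) ν) {G : ℂ → Y → ℂ}
    (hG : ∀ y, Differentiable ℂ fun s => G s y) (hmeas : ∀ s, AEStronglyMeasurable (G s) ν)
    {e : ℝ} (hle : ∀ S : ℝ, ∃ C : ℝ, 0 ≤ C ∧ ∀ᵐ y ∂ν, ∀ s : ℂ, ‖s‖ ≤ S → e - d * s.re ≤ 0 →
      ‖G s y‖ ≤ C * (1 + ‖ρ y‖) ^ (e - d * s.re)) {s : ℂ} (hs : (e + p) / d < s.re) :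
    Integrable (G s) ν ∧ DifferentiableAt ℂ (fun s => ∫ y, G s y ∂ν) s := by
  have hd' : (0 : ℝ) < d := Nat.cast_pos.2 hd
  have hp : (0 : ℝ) ≤ p := Nat.cast_nonneg p
  -- Half the distance to the abscissa, so that the exponent at `s.re - r` is still below `-p` and
  -- dominates on the whole ball.
  set r := (s.re - (e + p) / d) / 2 with hr
  have hr0 : 0 < r := by rw [hr]; linarith
  obtain ⟨C, hC, hCle⟩ := hle (‖s‖ + r)
  have hexp : e - d * (s.re - r) < -p := by
    have : (e + p) / d < s.re - r := by rw [hr]; linarith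
    rw [div_lt_iff₀ hd'] at this
    linarith
  have hB : Integrable (fun y => C * (1 + ‖ρ y‖) ^ (e - d * (s.re - r))) ν :=
    (hρ _ hexp).const_mul C
  have hbound : ∀ᵐ y ∂ν, ∀ z ∈ Metric.ball s r,
      ‖G z y‖ ≤ C * (1 + ‖ρ y‖) ^ (e - d * (s.re - r)) := by
    filter_upwards [hCle] with y hy z hz
    rw [mem_ball_iff_norm] at hz
    have h1 : ‖z‖ ≤ ‖s‖ + r := by
      have := norm_add_le (z - s) s
      rw [sub_add_cancel] at this
      linarith
    have h2 : s.re - r ≤ z.re := by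
      have := (abs_le.1 (Complex.abs_re_le_norm (z - s))).1
      rw [Complex.sub_re] at this
      linarith
    have h3 : e - d * z.re ≤ e - d * (s.re - r) := by
      have := mul_le_mul_of_nonneg_left h2 hd'.le
      linarith
    refine (hy z h1 (by linarith)).trans ?_
    refine mul_le_mul_of_nonneg_left ?_ hC
    exact Real.rpow_le_rpow_of_exponent_le (by simp) h3
  refine ⟨hB.mono' (hmeas s) (hbound.mono fun y hy => hy s (Metric.mem_ball_self hr0)), ?_⟩
  exact differentiableAt_integral_of_dominated hr0 hG hmeas hB hbound

variable {p : ℕ} {f : MvPolynomial (Fin p) ℂ} {ℓ : (Fin p → ℝ) → ℂ} {m : ℤ}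
  {μ : Measure (Fin p → ℝ)} {u : FormalSymbol p}

open FormalSymbol

theorem integrable_and_differentiableAt_eval (hf : IsEllipticOnOctant f) (hℓ : IsLogBranch f ℓ)
    (hc : Continuous ℓ) (hμ : IsOctantMeasure μ) (hu : u ∈ ofOrder f.totalDegree m) {s : ℂ}
    (hs : (m + p : ℝ) / f.totalDegree < s.re) :
    Integrable (fun x => eval ℓ s x u) μ ∧
      DifferentiableAt ℂ (fun s => ∫ x, eval ℓ s x u ∂μ) s := by
  refine integrable_and_differentiableAt_of_order hf.nonconstant (ρ := id) hμ.integrable_rpow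
    (G := fun s x => eval ℓ s x u) (fun x => differentiable_eval ℓ x u)
    (fun s => (continuous_eval hc s u).aestronglyMeasurable) (fun S => ?_) hs
  obtain ⟨C, hC, h⟩ := norm_eval_le hf hℓ hu S
  refine ⟨C, hC, ?_⟩
  filter_upwards [hμ.ae_mem] with x hx s hs _
  exact h s hs x hx

/-- Subtracting `M` Taylor terms moves the abscissa of convergence to the left by M/d. -/
theorem integrable_and_differentiableAt_taylorRem (hf : IsEllipticOnOctant f)
    (hℓ : IsLogBranch f ℓ) (hc : Continuous ℓ) (hμ : IsOctantMeasure μ)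
    (hu : u ∈ ofOrder f.totalDegree m) (M : ℕ) {t : Fin p → ℝ} (ht : t ∈ octant p) {s : ℂ}
    (hs : (m - M + p : ℝ) / f.totalDegree < s.re) :
    Integrable (fun x => taylorRem f ℓ u M s x t) μ ∧
      DifferentiableAt ℂ (fun s => ∫ x, taylorRem f ℓ u M s x t ∂μ) s := by
  refine integrable_and_differentiableAt_of_order hf.nonconstant (ρ := id) hμ.integrable_rpow
    (G := fun s x => taylorRem f ℓ u M s x t) (fun x => differentiable_taylorRem f ℓ u M x t)
    (fun s => ((continuous_taylorRem f hc u M s).comp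
      (Continuous.prodMk_left t)).aestronglyMeasurable) (fun S => ?_) hs
  obtain ⟨C, hC, h⟩ := exists_norm_taylorRem_le hf hℓ hu M S ‖t‖
  refine ⟨C, hC, ?_⟩
  filter_upwards [hμ.ae_mem] with x hx s hs hneg
  exact h s hs hneg x hx t ht le_rfl

theorem integrable_and_differentiableAt_taylorRem_prodCube [SFinite μ] (hf : IsEllipticOnOctant f)
    (hℓ : IsLogBranch f ℓ) (hc : Continuous ℓ) (hμ : IsOctantMeasure μ)
    (hu : u ∈ ofOrder f.totalDegree m) (M : ℕ) {s : ℂ}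
    (hs : (m - M + p : ℝ) / f.totalDegree < s.re) :
    Integrable (fun y => taylorRem f ℓ u M s y.1 y.2) (prodCube μ) ∧
      DifferentiableAt ℂ (fun s => ∫ y, taylorRem f ℓ u M s y.1 y.2 ∂prodCube μ) s := by
  refine integrable_and_differentiableAt_of_order hf.nonconstant (ρ := Prod.fst)
    hμ.integrable_rpow_prodCube (G := fun s y => taylorRem f ℓ u M s y.1 y.2)
    (fun y => differentiable_taylorRem f ℓ u M y.1 y.2)
    (fun s => (continuous_taylorRem f hc u M s).aestronglyMeasurable) (fun S => ?_) hs
  obtain ⟨C, hC, h⟩ := exists_norm_taylorRem_le hf hℓ hu M S 1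
  refine ⟨C, hC, ?_⟩
  filter_upwards [hμ.ae_prodCube] with y hy s hs hneg
  exact h s hs hneg y.1 hy.1 y.2 (Icc_subset_octant hy.2) (norm_le_one_of_mem_Icc hy.2)

end Dominated

/-! ### Possible poles -/

section

open FormalSymbol

/-- The possible poles for symbols of order `m`. -/
def polesOfOrder (p d : ℕ) (m : ℤ) : Set ℂ :=
  {s | (∃ l : ℕ, s = ((m : ℂ) + p - l) / d) ∧ ∀ N : ℕ, s ≠ -(N : ℂ)}

section Poles

variable {p d : ℕ} {m : ℤ}

theorem polesOfOrder_sub_subset (j : ℕ) : polesOfOrder p d (m - j) ⊆ polesOfOrder p d m := by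
  rintro s ⟨⟨l, rfl⟩, hs⟩
  refine ⟨⟨l + j, ?_⟩, hs⟩
  push_cast
  ring

theorem re_le_of_mem_polesOfOrder {s : ℂ} (hs : s ∈ polesOfOrder p d m) :
    s.re ≤ (m + p : ℝ) / d := by
  obtain ⟨⟨l, rfl⟩, -⟩ := hs
  have : (((m : ℂ) + p - l) / d) = (((m + p - l : ℝ) / d : ℝ) : ℂ) := by push_cast; rfl
  rw [this, Complex.ofReal_re]
  gcongr
  have : (0 : ℝ) ≤ l := Nat.cast_nonneg l
  linarith

theorem possiblePoles_eq {f g : MvPolynomial (Fin p) ℂ} :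
    possiblePoles f g = polesOfOrder p f.totalDegree g.totalDegree := by
  simp [possiblePoles, polesOfOrder]

end Poles

/-! ### The scaling identity for integrals -/

section EulerIdentity

variable {p : ℕ} {f : MvPolynomial (Fin p) ℂ} {ℓ : (Fin p → ℝ) → ℂ} {m : ℤ} {u : FormalSymbol p}

open scoped Pointwise in
theorem smul_octant {c : ℝ} (hc : 0 < c) : c • octant p = octant p := by
  ext x
  rw [Set.mem_smul_set_iff_inv_smul_mem₀ hc.ne']
  refine ⟨fun h => ?_, fun h => smul_mem_octant h (by positivity)⟩
  have := smul_mem_octant h hc.le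
  rwa [smul_inv_smul₀ hc.ne'] at this

/-- Differentiating ∫ u(cx) dx = c^(-p) ∫ u at c = 1 gives ∫ ∑ x_i ∂_i u = -p ∫ u, which is inserted
into `eval_euler`. -/
theorem integral_euler (hf : IsEllipticOnOctant f) (hℓ : IsLogBranch f ℓ) (hc : Continuous ℓ)
    (hu : u ∈ ofOrder f.totalDegree m) {s : ℂ} (hs : (m + p : ℝ) / f.totalDegree < s.re) :
    ∫ x in octant p, eval ℓ s x (euler f m u) =
      (m + p - s * f.totalDegree) * ∫ x in octant p, eval ℓ s x u := by
  have hd : (0 : ℝ) < f.totalDegree := Nat.cast_pos.2 hf.nonconstant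
  have hexp : m - f.totalDegree * s.re < -p := by
    rw [div_lt_iff₀ hd] at hs; linarith
  have hp : (0 : ℝ) ≤ p := Nat.cast_nonneg p
  have hint : Integrable (fun x => eval ℓ s x u) (volume.restrict (octant p)) :=
    (integrable_and_differentiableAt_eval hf hℓ hc isOctantMeasure_volume hu hs).1
  set W : ℂ := ∫ x in octant p, eval ℓ s x u with hW
  choose C hC0 hC using fun i => norm_eval_le hf hℓ (deriv_mem_ofOrder i hu) ‖s‖
  set e : ℝ := m - f.totalDegree * s.re with he
  have hmem : ∀ c ∈ Metric.ball (1 : ℝ) (1 / 2), 1 / 2 < c := by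
    intro c hcb
    rw [mem_ball_iff_norm, Real.norm_eq_abs, abs_lt] at hcb
    linarith
  have key := hasDerivAt_integral_of_dominated_loc_of_deriv_le
    (μ := volume.restrict (octant p)) (x₀ := (1 : ℝ)) (s := Metric.ball (1 : ℝ) (1 / 2))
    (F := fun c x => eval ℓ s (c • x) u)
    (F' := fun c x => ∑ i, (x i : ℂ) * eval ℓ s (c • x) (deriv f i u))
    -- For c > 1/2 one has 1 + ‖cx‖ ≥ (1 + ‖x‖)/2. The derivatives have exponent e - 1 < 0, whence
    -- the factor 2^(1-e); the factor x_i restores the exponent e.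
    (bound := fun x => ∑ i, C i * 2 ^ (1 - e) * (1 + ‖x‖) ^ e)
    (Metric.ball_mem_nhds _ (by norm_num))
    (Filter.Eventually.of_forall fun c =>
      ((continuous_eval hc s u).comp (continuous_const_smul c)).aestronglyMeasurable)
    (by simpa using hint)
    (Continuous.aestronglyMeasurable (continuous_finsetSum _ fun i _ =>
      Continuous.mul (by fun_prop) ((continuous_eval hc s _).comp (continuous_const_smul _))))
    (by
      filter_upwards [ae_restrict_mem measurableSet_octant] with x hx c hcb
      have hc2 := hmem c hcb
      refine (norm_sum_le _ _).trans (Finset.sum_le_sum fun i _ => ?_)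
      rw [norm_mul, Complex.norm_real]
      have h1 := hC i s le_rfl (c • x) (smul_mem_octant hx (by linarith))
      have h2 : ((m - 1 : ℤ) - f.totalDegree * s.re : ℝ) = e - 1 := by
        push_cast; rw [he]; ring
      rw [h2] at h1
      have hpos : 0 < 1 + ‖x‖ := by positivity
      have h3 : (1 + ‖c • x‖) ^ (e - 1) ≤ 2 ^ (1 - e) * (1 + ‖x‖) ^ (e - 1) := by
        have h4 : (2 : ℝ) ^ (1 - e) = (1 / 2) ^ (e - 1) := by
          rw [one_div, Real.inv_rpow (by norm_num), ← Real.rpow_neg (by norm_num)]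
          congr 1; ring
        rw [h4, ← Real.mul_rpow (by norm_num) hpos.le]
        refine Real.rpow_le_rpow_of_nonpos (by positivity) ?_ (by linarith)
        rw [norm_smul, Real.norm_of_nonneg (by linarith)]
        nlinarith [norm_nonneg x]
      calc ‖x i‖ * ‖eval ℓ s (c • x) (deriv f i u)‖
          ≤ (1 + ‖x‖) * (C i * (2 ^ (1 - e) * (1 + ‖x‖) ^ (e - 1))) := by
            gcongr
            · linarith [norm_le_pi_norm x i]
            · exact h1.trans (mul_le_mul_of_nonneg_left h3 (hC0 i))
        _ = C i * 2 ^ (1 - e) * ((1 + ‖x‖) ^ (e - 1) * (1 + ‖x‖) ^ (1 : ℝ)) := by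
            rw [Real.rpow_one]; ring
        _ = C i * 2 ^ (1 - e) * (1 + ‖x‖) ^ e := by
            rw [← Real.rpow_add hpos, sub_add_cancel])
    (integrable_finsetSum _ fun i _ =>
      (isOctantMeasure_volume.integrable_rpow e hexp).const_mul _)
    (by
      filter_upwards [ae_restrict_mem measurableSet_octant] with x hx c hcb
      have hc2 := hmem c hcb
      have := (hasDerivWithinAt_eval hℓ s zero_mem_octant hx (by linarith : 0 ≤ c) u).hasDerivAt
        (Ici_mem_nhds (by linarith))
      simpa only [zero_add] using this)
  obtain ⟨hint', hder⟩ := key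
  simp only [one_smul] at hint' hder
  have hder2 : HasDerivAt (fun c : ℝ => ∫ x in octant p, eval ℓ s (c • x) u) (-(p : ℂ) * W) 1 := by
    have h1 : HasDerivAt (fun c : ℝ => (((c ^ p)⁻¹ : ℝ) : ℂ) * W) (-(p : ℂ) * W) 1 := by
      have := ((hasDerivAt_pow p (1 : ℝ)).fun_inv (by simp)).ofReal_comp.mul_const W
      simpa using this
    refine h1.congr_of_eventuallyEq ?_
    filter_upwards [Ioi_mem_nhds (zero_lt_one (α := ℝ))] with c hc0
    rw [Measure.setIntegral_comp_smul_of_pos volume (fun x => eval ℓ s x u) _ hc0,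
      smul_octant hc0, Module.finrank_fin_fun, Complex.real_smul]
  have hEq := hder.unique hder2
  have h3 : ∫ x in octant p, eval ℓ s x (euler f m u) = ∫ x in octant p,
      ((m - s * f.totalDegree) * eval ℓ s x u - ∑ i, (x i : ℂ) * eval ℓ s x (deriv f i u)) :=
    setIntegral_congr_fun measurableSet_octant fun x hx => eval_euler hℓ s hx u
  rw [h3, integral_sub (hint.const_mul _) hint', integral_const_mul, hEq]
  ring

end EulerIdentity

/-! ### Continuation of integrals and of series -/

section Continuations

variable {p : ℕ} {f : MvPolynomial (Fin p) ℂ} {ℓ : (Fin p → ℝ) → ℂ}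

/-- All integrals of symbols against `μ` have meromorphic continuations. -/
def HasContinuations (f : MvPolynomial (Fin p) ℂ) (ℓ : (Fin p → ℝ) → ℂ)
    (μ : Measure (Fin p → ℝ)) : Prop :=
  ∀ (m : ℤ) (u : FormalSymbol p), u ∈ ofOrder f.totalDegree m → ∀ b : ℝ,
    ∃ ψ, ContinuesTo (polesOfOrder p f.totalDegree m) b ((m + p : ℝ) / f.totalDegree)
      (fun s => ∫ x, eval ℓ s x u ∂μ) ψ

/-- Reduction to an induction on `K`, each step gaining 1/d. The order `m` is quantified after `K`,
because the step for order `m` uses symbols of lower order. -/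
theorem hasContinuations_of_nat (hf : IsEllipticOnOctant f) {μ : Measure (Fin p → ℝ)}
    (h : ∀ (K : ℕ) (m : ℤ) (u : FormalSymbol p), u ∈ ofOrder f.totalDegree m →
      ∃ ψ, ContinuesTo (polesOfOrder p f.totalDegree m) ((m + p - K : ℝ) / f.totalDegree)
        ((m + p : ℝ) / f.totalDegree) (fun s => ∫ x, eval ℓ s x u ∂μ) ψ) :
    HasContinuations f ℓ μ := by
  intro m u hu b
  have hd : (0 : ℝ) < f.totalDegree := Nat.cast_pos.2 hf.nonconstant
  obtain ⟨K, hK⟩ := exists_nat_ge (m + p - b * f.totalDegree : ℝ)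
  obtain ⟨ψ, hψ⟩ := h K m u hu
  refine ⟨ψ, hψ.mono subset_rfl ?_ le_rfl⟩
  rw [div_le_iff₀ hd]
  linarith

theorem hasContinuations_volume (hf : IsEllipticOnOctant f) (hℓ : IsLogBranch f ℓ)
    (hc : Continuous ℓ) : HasContinuations f ℓ (volume.restrict (octant p)) := by
  have hd : (0 : ℝ) < f.totalDegree := Nat.cast_pos.2 hf.nonconstant
  have hdC : (f.totalDegree : ℂ) ≠ 0 := Nat.cast_ne_zero.2 hf.nonconstant.ne'
  refine hasContinuations_of_nat hf fun K => ?_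
  induction K with
  | zero =>
    intro m u hu
    refine ⟨_, .of_differentiableAt fun s hs => ?_⟩
    rw [Nat.cast_zero, sub_zero] at hs
    exact (integrable_and_differentiableAt_eval hf hℓ hc isOctantMeasure_volume hu hs).2
  | succ K ih =>
    intro m u hu
    have hu' := euler_mem_ofOrder hu
    obtain ⟨ψ, hψ⟩ := ih (m - 1) (euler f m u) hu'
    have hlt : ((m - 1 : ℤ) + p : ℝ) / f.totalDegree < (m + p : ℝ) / f.totalDegree := by
      refine div_lt_div_of_pos_right ?_ hd
      push_cast
      linarith
    have hre : (((m : ℂ) + p) / f.totalDegree) = (((m + p : ℝ) / f.totalDegree : ℝ) : ℂ) := by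
      push_cast; rfl
    have hψ' := hψ.mono (b' := (m + p - (K + 1 : ℕ) : ℝ) / f.totalDegree)
      (polesOfOrder_sub_subset (m := m) 1) (by apply le_of_eq; congr 1; push_cast; ring) hlt.le
    refine hψ'.exists_div_linear (A := m + p) hdC (fun s hs => ?_) ?_ ?_
    · exact (integral_euler hf hℓ hc hu hs).symm
    · rw [hre, Complex.ofReal_re]
    -- If the zero of the linear factor is -N, it is not a possible pole and the dividend must
    -- vanish there. It lies in the half-plane where the integral of the new symbol converges, and
    -- that symbol vanishes at -N because m - 1 + Nd = -p - 1 < 0.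
    · by_cases hN : ∃ N : ℕ, ((m : ℂ) + p) / f.totalDegree = -(N : ℂ)
      · right
        obtain ⟨N, hN⟩ := hN
        have hlt' : ((m - 1 : ℤ) + p : ℝ) / f.totalDegree <
            (((m : ℂ) + p) / f.totalDegree).re := by
          rw [hre, Complex.ofReal_re]; exact hlt
        rw [hψ.eq _ hlt', hN]
        rw [div_eq_iff hdC] at hN
        have hN' : m + p = -N * f.totalDegree := by exact_mod_cast hN
        have hneg : m - 1 + N * f.totalDegree < 0 := by
          linarith [Int.natCast_nonneg p]
        simp only [eval_neg_natCast_eq_zero hneg hu', integral_zero]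
      · left
        push Not at hN
        exact ⟨⟨0, by simp⟩, hN⟩

/-- The integral of a Taylor coefficient over the unit cube. -/
noncomputable def cubeCoeff {j : ℕ} (w : Fin j → Fin p) : ℂ :=
  ∫ t in Set.Icc (0 : Fin p → ℝ) 1, taylorCoeff t w

theorem continuous_taylorCoeff {j : ℕ} (w : Fin j → Fin p) :
    Continuous fun t : Fin p → ℝ => taylorCoeff t w := by
  unfold taylorCoeff; fun_prop

theorem integrableOn_taylorCoeff {j : ℕ} (w : Fin j → Fin p) :
    IntegrableOn (fun t : Fin p → ℝ => taylorCoeff t w) (Set.Icc 0 1) :=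
  (continuous_taylorCoeff w).continuousOn.integrableOn_compact isCompact_Icc

variable {m : ℤ} {u : FormalSymbol p}

theorem iterDeriv_ofFn_mem {j : ℕ} (hu : u ∈ ofOrder f.totalDegree m) (w : Fin j → Fin p) :
    iterDeriv f (List.ofFn w) u ∈ ofOrder f.totalDegree (m - j) := by
  have := iterDeriv_mem_ofOrder (List.ofFn w) hu
  rwa [List.length_ofFn] at this

/-- Taylor's formula, integrated over the unit cube and summed over the lattice points. -/
theorem integral_octant_eq (hf : IsEllipticOnOctant f) (hℓ : IsLogBranch f ℓ)
    (hc : Continuous ℓ) (hu : u ∈ ofOrder f.totalDegree m) (M : ℕ) {s : ℂ}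
    (hs : (m + p : ℝ) / f.totalDegree < s.re) :
    ∫ x in octant p, eval ℓ s x u =
      ∑ j ∈ Finset.range M, ∑ w : Fin j → Fin p,
        cubeCoeff w * ∫ x, eval ℓ s x (iterDeriv f (List.ofFn w) u) ∂latticeMeasure p +
      ∫ y, taylorRem f ℓ u M s y.1 y.2 ∂prodCube (latticeMeasure p) := by
  have hsub : ∀ j : ℕ, (m - j + p : ℝ) / f.totalDegree < s.re := by
    intro j
    refine lt_of_le_of_lt ?_ hs
    gcongr
    linarith [(Nat.cast_nonneg j : (0 : ℝ) ≤ j)]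
  have hI : ∀ (j : ℕ) (w : Fin j → Fin p), Integrable
      (fun x => eval ℓ s x (iterDeriv f (List.ofFn w) u)) (latticeMeasure p) := fun j w =>
    (integrable_and_differentiableAt_eval hf hℓ hc isOctantMeasure_latticeMeasure
      (iterDeriv_ofFn_mem hu w) (by push_cast; exact hsub j)).1
  have hterm : ∀ (j : ℕ) (w : Fin j → Fin p), Integrable
      (fun y : (Fin p → ℝ) × (Fin p → ℝ) =>
        taylorCoeff y.2 w * eval ℓ s y.1 (iterDeriv f (List.ofFn w) u))
      (prodCube (latticeMeasure p)) := by
    intro j w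
    have := (hI j w).mul_prod (integrableOn_taylorCoeff w)
    simpa only [mul_comm] using this
  have hR := (integrable_and_differentiableAt_taylorRem_prodCube hf hℓ hc
    isOctantMeasure_latticeMeasure hu M (hsub M)).1
  have hS : Integrable (fun y : (Fin p → ℝ) × (Fin p → ℝ) => ∑ j ∈ Finset.range M,
      ∑ w : Fin j → Fin p, taylorCoeff y.2 w * eval ℓ s y.1 (iterDeriv f (List.ofFn w) u))
      (prodCube (latticeMeasure p)) :=
    integrable_finsetSum _ fun j _ => integrable_finsetSum _ fun w _ => hterm j w
  have hsplit : ∀ y : (Fin p → ℝ) × (Fin p → ℝ), eval ℓ s (y.1 + y.2) u =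
      (∑ j ∈ Finset.range M, ∑ w : Fin j → Fin p,
        taylorCoeff y.2 w * eval ℓ s y.1 (iterDeriv f (List.ofFn w) u)) +
      taylorRem f ℓ u M s y.1 y.2 := fun y => by rw [taylorRem, add_sub_cancel]
  have hE : Integrable (fun y : (Fin p → ℝ) × (Fin p → ℝ) => eval ℓ s (y.1 + y.2) u)
      (prodCube (latticeMeasure p)) := by
    simp only [hsplit]
    exact hS.add hR
  rw [← integral_prodCube_latticeMeasure (F := fun x => eval ℓ s x u)
    (integrable_and_differentiableAt_eval hf hℓ hc isOctantMeasure_volume hu hs).1 hE]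
  simp only [hsplit]
  rw [integral_add hS hR, integral_finsetSum _ fun j _ =>
    integrable_finsetSum _ fun w _ => hterm j w]
  congr 1
  refine Finset.sum_congr rfl fun j _ => ?_
  rw [integral_finsetSum _ fun w _ => hterm j w]
  refine Finset.sum_congr rfl fun w _ => ?_
  have := integral_prod_mul (μ := latticeMeasure p)
    (ν := volume.restrict (Set.Icc (0 : Fin p → ℝ) 1))
    (fun x => eval ℓ s x (iterDeriv f (List.ofFn w) u)) (fun t => taylorCoeff t w)
  rw [cubeCoeff, mul_comm, ← this]
  simp only [mul_comm]

/-- Solve the integrated Taylor formula for its term `j = 0`, the series of `u`. The integral is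
already continued, and the terms with `j ≥ 1` have order at most `m - 1`, so the induction
hypothesis for `K` reaches far enough. -/
theorem hasContinuations_latticeMeasure (hf : IsEllipticOnOctant f) (hℓ : IsLogBranch f ℓ)
    (hc : Continuous ℓ) : HasContinuations f ℓ (latticeMeasure p) := by
  have hd : (0 : ℝ) < f.totalDegree := Nat.cast_pos.2 hf.nonconstant
  refine hasContinuations_of_nat hf fun K => ?_
  induction K with
  | zero =>
    intro m u hu
    refine ⟨_, .of_differentiableAt fun s hs => ?_⟩
    rw [Nat.cast_zero, sub_zero] at hs
    exact (integrable_and_differentiableAt_eval hf hℓ hc isOctantMeasure_latticeMeasure hu hs).2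
  | succ K ih =>
    intro m u hu
    obtain ⟨ψ₀, hψ₀⟩ := hasContinuations_volume hf hℓ hc m u hu
      ((m + p - (K + 1 : ℕ) : ℝ) / f.totalDegree)
    have hw : ∀ (j : ℕ) (w : Fin (j + 1) → Fin p), ∃ ψ,
        ContinuesTo (polesOfOrder p f.totalDegree m) ((m + p - (K + 1 : ℕ) : ℝ) / f.totalDegree)
          ((m + p : ℝ) / f.totalDegree)
          (fun s => ∫ x, eval ℓ s x (iterDeriv f (List.ofFn w) u) ∂latticeMeasure p) ψ := by
      intro j w
      obtain ⟨ψ, hψ⟩ := ih _ _ (iterDeriv_ofFn_mem hu w)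
      refine ⟨ψ, hψ.mono (polesOfOrder_sub_subset _) ?_ ?_⟩
      · refine div_le_div_of_nonneg_right ?_ hd.le
        push_cast
        linarith [(Nat.cast_nonneg j : (0 : ℝ) ≤ j)]
      · refine div_le_div_of_nonneg_right ?_ hd.le
        push_cast
        linarith [(Nat.cast_nonneg j : (0 : ℝ) ≤ j)]
    choose ψ hψ using hw
    have hR : ContinuesTo (polesOfOrder p f.totalDegree m)
        ((m + p - (K + 1 : ℕ) : ℝ) / f.totalDegree) ((m + p : ℝ) / f.totalDegree)
        (fun s => ∫ y, taylorRem f ℓ u (K + 1) s y.1 y.2 ∂prodCube (latticeMeasure p))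
        (fun s => ∫ y, taylorRem f ℓ u (K + 1) s y.1 y.2 ∂prodCube (latticeMeasure p)) := by
      refine .of_differentiableAt fun s hs => ?_
      refine (integrable_and_differentiableAt_taylorRem_prodCube hf hℓ hc
        isOctantMeasure_latticeMeasure hu (K + 1) ?_).2
      rwa [sub_add_eq_add_sub]
    refine ⟨_, ((hψ₀.sub (ContinuesTo.sum (Finset.range K) fun j _ =>
      ContinuesTo.sum Finset.univ fun w _ => (hψ j w).const_mul (cubeCoeff w))).sub hR).congr
        fun s hs => ?_⟩
    -- There is one empty word, and its coefficient is the volume of the unit cube.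
    have h0 : ∑ w : Fin 0 → Fin p, cubeCoeff w * ∫ x, eval ℓ s x (iterDeriv f (List.ofFn w) u)
        ∂latticeMeasure p = ∫ x, eval ℓ s x u ∂latticeMeasure p := by
      simp [cubeCoeff, taylorCoeff, iterDeriv, Measure.real, Real.volume_Icc_pi]
    rw [integral_octant_eq hf hℓ hc hu (K + 1) hs, Finset.sum_range_succ', h0]
    ring

end Continuations

/-! ### Taylor expansion of continuations in the shift -/

section ShiftExpansion

variable {p : ℕ} {f : MvPolynomial (Fin p) ℂ} {ℓ : (Fin p → ℝ) → ℂ} {m : ℤ} {u : FormalSymbol p}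
  {μ : Measure (Fin p → ℝ)}

theorem integrable_eval_add (hf : IsEllipticOnOctant f) (hℓ : IsLogBranch f ℓ) (hc : Continuous ℓ)
    (hμ : IsOctantMeasure μ) (hu : u ∈ ofOrder f.totalDegree m) {t : Fin p → ℝ}
    (ht : t ∈ octant p) {s : ℂ} (hs : (m + p : ℝ) / f.totalDegree < s.re) :
    Integrable (fun x => eval ℓ s (x + t) u) μ := by
  have := (integrable_and_differentiableAt_taylorRem hf hℓ hc hμ hu 0 ht (s := s)
    (by simpa using hs)).1
  simpa [taylorRem] using this

theorem HasContinuations.exists_iterDeriv (h : HasContinuations f ℓ μ)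
    (hu : u ∈ ofOrder f.totalDegree m) (b : ℝ) :
    ∃ ψ : ∀ j : ℕ, (Fin j → Fin p) → ℂ → ℂ, ∀ j w,
      ContinuesTo (polesOfOrder p f.totalDegree m) b ((m + p : ℝ) / f.totalDegree)
        (fun s => ∫ x, eval ℓ s x (iterDeriv f (List.ofFn w) u) ∂μ) (ψ j w) := by
  have : ∀ (j : ℕ) (w : Fin j → Fin p), ∃ ψ,
      ContinuesTo (polesOfOrder p f.totalDegree m) b ((m + p : ℝ) / f.totalDegree)
        (fun s => ∫ x, eval ℓ s x (iterDeriv f (List.ofFn w) u) ∂μ) ψ := by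
    intro j w
    obtain ⟨ψ, hψ⟩ := h _ _ (iterDeriv_ofFn_mem hu w) b
    refine ⟨ψ, hψ.mono (polesOfOrder_sub_subset _) le_rfl ?_⟩
    refine div_le_div_of_nonneg_right ?_ (Nat.cast_nonneg _)
    push_cast
    linarith [(Nat.cast_nonneg j : (0 : ℝ) ≤ j)]
  choose ψ hψ using this
  exact ⟨ψ, hψ⟩

/-- The Taylor expansion of the continuation in the shift. -/
theorem eq_sum_taylorCoeff_add (hf : IsEllipticOnOctant f) (hℓ : IsLogBranch f ℓ)
    (hc : Continuous ℓ) (hμ : IsOctantMeasure μ) (hu : u ∈ ofOrder f.totalDegree m) {M : ℕ} {b : ℝ}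
    (hb : b = (m - M + p : ℝ) / f.totalDegree)
    {ψ : ∀ j : ℕ, (Fin j → Fin p) → ℂ → ℂ} (hψ : ∀ j w,
      ContinuesTo (polesOfOrder p f.totalDegree m) b ((m + p : ℝ) / f.totalDegree)
        (fun s => ∫ x, eval ℓ s x (iterDeriv f (List.ofFn w) u) ∂μ) (ψ j w))
    {t : Fin p → ℝ} (ht : t ∈ octant p) {Ψ : ℂ → ℂ}
    (hΨ : ContinuesTo (polesOfOrder p f.totalDegree m) b ((m + p : ℝ) / f.totalDegree)
      (fun s => ∫ x, eval ℓ s (x + t) u ∂μ) Ψ) {s : ℂ} (hs : b < s.re)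
    (hsP : s ∉ polesOfOrder p f.totalDegree m) :
    Ψ s = ∑ j ∈ Finset.range M, ∑ w : Fin j → Fin p, taylorCoeff t w * ψ j w s +
      ∫ x, taylorRem f ℓ u M s x t ∂μ := by
  have hsub : ∀ {z : ℂ}, (m + p : ℝ) / f.totalDegree < z.re →
      ∀ j : ℕ, (m - j + p : ℝ) / f.totalDegree < z.re := by
    intro z hz j
    refine lt_of_le_of_lt ?_ hz
    gcongr
    linarith [(Nat.cast_nonneg j : (0 : ℝ) ≤ j)]
  have hR : ContinuesTo (polesOfOrder p f.totalDegree m) b ((m + p : ℝ) / f.totalDegree)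
      (fun s => ∫ x, taylorRem f ℓ u M s x t ∂μ) (fun s => ∫ x, taylorRem f ℓ u M s x t ∂μ) :=
    .of_differentiableAt fun s hs =>
      (integrable_and_differentiableAt_taylorRem hf hℓ hc hμ hu M ht (by rwa [← hb])).2
  refine hΨ.eq_of_eq_on ((ContinuesTo.sum (Finset.range M) fun j _ =>
    ContinuesTo.sum Finset.univ fun w _ => (hψ j w).const_mul (taylorCoeff t w)).add hR)
    (fun z hz => ?_) hs hsP
  have hI : ∀ (j : ℕ) (w : Fin j → Fin p), Integrable
      (fun x => taylorCoeff t w * eval ℓ z x (iterDeriv f (List.ofFn w) u)) μ := fun j w =>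
    (integrable_and_differentiableAt_eval hf hℓ hc hμ
      (iterDeriv_ofFn_mem hu w) (by push_cast; exact hsub hz j)).1.const_mul _
  have hsum : Integrable (fun x => ∑ j ∈ Finset.range M, ∑ w : Fin j → Fin p,
      taylorCoeff t w * eval ℓ z x (iterDeriv f (List.ofFn w) u)) μ :=
    integrable_finsetSum _ fun j _ => integrable_finsetSum _ fun w _ => hI j w
  have hrem : ∫ x, taylorRem f ℓ u M z x t ∂μ = ∫ x, eval ℓ z (x + t) u ∂μ -
      ∑ j ∈ Finset.range M, ∑ w : Fin j → Fin p,
        taylorCoeff t w * ∫ x, eval ℓ z x (iterDeriv f (List.ofFn w) u) ∂μ := by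
    unfold taylorRem
    rw [integral_sub (integrable_eval_add hf hℓ hc hμ hu ht hz) hsum,
      integral_finsetSum _ fun j _ => integrable_finsetSum _ fun w _ => hI j w]
    congr 1
    refine Finset.sum_congr rfl fun j _ => ?_
    rw [integral_finsetSum _ fun w _ => hI j w]
    exact Finset.sum_congr rfl fun w _ => integral_const_mul _ _
  rw [hrem, add_sub_cancel]

theorem neg_natCast_notMem_polesOfOrder (d : ℕ) (N : ℕ) : -(N : ℂ) ∉ polesOfOrder p d m :=
  fun h => h.2 N rfl

/-- At a non-positive integer the continuation is a polynomial in the shift. -/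
theorem exists_polynomial_value (hf : IsEllipticOnOctant f) (hℓ : IsLogBranch f ℓ)
    (hc : Continuous ℓ) (hμ : IsOctantMeasure μ) (hcont : HasContinuations f ℓ μ) {n : ℕ}
    (hu : u ∈ ofOrder f.totalDegree n) (N : ℕ) :
    ∃ Q : MvPolynomial (Fin p) ℂ, Q.totalDegree ≤ N * f.totalDegree + n + p ∧
      ∀ t ∈ octant p, ∀ Ψ : ℂ → ℂ,
        (∀ b : ℝ, ContinuesTo (polesOfOrder p f.totalDegree n) b ((n + p : ℝ) / f.totalDegree)
          (fun s => ∫ x, eval ℓ s (x + t) u ∂μ) Ψ) → Ψ (-(N : ℂ)) = evalReal Q t := by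
  have hd : (0 : ℝ) < f.totalDegree := Nat.cast_pos.2 hf.nonconstant
  -- The remainder vanishes at -N as soon as M > Nd + n. The additional p makes its integral
  -- holomorphic near -N, so that the expansion is valid there; the degrees `j < M` then give
  -- exactly the stated bound.
  set M := N * f.totalDegree + n + p + 1 with hM
  set b : ℝ := (((n : ℤ) : ℝ) - M + p) / f.totalDegree with hb
  have hbN : b < (-(N : ℂ)).re := by
    rw [hb, hM, div_lt_iff₀ hd]
    push_cast
    simp only [Complex.neg_re, Complex.natCast_re]
    linarith
  obtain ⟨ψ, hψ⟩ := hcont.exists_iterDeriv hu b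
  refine ⟨∑ j ∈ Finset.range M, ∑ w : Fin j → Fin p,
    MvPolynomial.C (ψ j w (-(N : ℂ)) / (j.factorial : ℂ)) * ∏ k, MvPolynomial.X (w k), ?_, ?_⟩
  · refine MvPolynomial.totalDegree_finsetSum_le fun j hj =>
      MvPolynomial.totalDegree_finsetSum_le fun w _ => ?_
    refine (MvPolynomial.totalDegree_mul _ _).trans ?_
    rw [MvPolynomial.totalDegree_C, zero_add]
    refine (MvPolynomial.totalDegree_finsetProd _ _).trans ?_
    have hj' := Finset.mem_range.1 hj
    simp only [MvPolynomial.totalDegree_X, Finset.sum_const, Finset.card_univ, Fintype.card_fin,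
      smul_eq_mul, mul_one]
    omega
  · intro t ht Ψ hΨ
    rw [eq_sum_taylorCoeff_add hf hℓ hc hμ hu hb hψ ht (Ψ := Ψ) (hΨ b) hbN
      (neg_natCast_notMem_polesOfOrder _ N)]
    have hrem : ∫ x, taylorRem f ℓ u M (-(N : ℂ)) x t ∂μ = 0 := by
      refine integral_eq_zero_of_ae ?_
      filter_upwards [hμ.ae_mem] with x hx
      refine taylorRem_neg_natCast_eq_zero hℓ hu ?_ hx ht
      rw [hM]
      push_cast
      linarith [Int.natCast_nonneg p]
    rw [hrem, add_zero, evalReal, map_sum]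
    refine Finset.sum_congr rfl fun j _ => ?_
    rw [map_sum]
    refine Finset.sum_congr rfl fun w _ => ?_
    simp only [map_mul, map_prod, MvPolynomial.eval_C, MvPolynomial.eval_X, taylorCoeff]
    ring

/-- The Raabe formula for continuations. -/
theorem integral_cube_continuation (hf : IsEllipticOnOctant f) (hℓ : IsLogBranch f ℓ)
    (hc : Continuous ℓ) (hu : u ∈ ofOrder f.totalDegree m) {Z : ℂ → ℂ}
    (hZ : ∀ b : ℝ, ContinuesTo (polesOfOrder p f.totalDegree m) b ((m + p : ℝ) / f.totalDegree)
      (fun s => ∫ x in octant p, eval ℓ s x u) Z) {Ψ : (Fin p → ℝ) → ℂ → ℂ}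
    (hΨ : ∀ t ∈ octant p, ∀ b : ℝ,
      ContinuesTo (polesOfOrder p f.totalDegree m) b ((m + p : ℝ) / f.totalDegree)
        (fun s => ∫ x, eval ℓ s (x + t) u ∂latticeMeasure p) (Ψ t)) {s : ℂ}
    (hsP : s ∉ polesOfOrder p f.totalDegree m) :
    IntegrableOn (fun t => Ψ t s) (Set.Icc 0 1) ∧ Z s = ∫ t in Set.Icc 0 1, Ψ t s := by
  have hd : (0 : ℝ) < f.totalDegree := Nat.cast_pos.2 hf.nonconstant
  obtain ⟨M, hM⟩ := exists_nat_gt (m + p - s.re * f.totalDegree : ℝ)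
  set b : ℝ := (m - M + p : ℝ) / f.totalDegree with hb
  have hbs : b < s.re := by
    rw [hb, div_lt_iff₀ hd]; linarith
  obtain ⟨ψ, hψ⟩ := (hasContinuations_latticeMeasure hf hℓ hc).exists_iterDeriv hu b
  have hval : ∀ t ∈ Set.Icc (0 : Fin p → ℝ) 1, Ψ t s =
      ∑ j ∈ Finset.range M, ∑ w : Fin j → Fin p, taylorCoeff t w * ψ j w s +
      ∫ x, taylorRem f ℓ u M s x t ∂latticeMeasure p := fun t ht =>
    eq_sum_taylorCoeff_add hf hℓ hc isOctantMeasure_latticeMeasure hu hb hψ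
      (Icc_subset_octant ht) (hΨ t (Icc_subset_octant ht) b) hbs hsP
  have hRprod := (integrable_and_differentiableAt_taylorRem_prodCube hf hℓ hc
    isOctantMeasure_latticeMeasure hu M hbs).1
  have hRint := hRprod.integral_prod_right
  have hterm : ∀ (j : ℕ) (w : Fin j → Fin p),
      IntegrableOn (fun t => taylorCoeff t w * ψ j w s) (Set.Icc (0 : Fin p → ℝ) 1) := fun j w =>
    (integrableOn_taylorCoeff w).mul_const _
  have hsum : IntegrableOn (fun t => ∑ j ∈ Finset.range M, ∑ w : Fin j → Fin p,
      taylorCoeff t w * ψ j w s) (Set.Icc (0 : Fin p → ℝ) 1) :=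
    integrable_finsetSum _ fun j _ => integrable_finsetSum _ fun w _ => hterm j w
  refine ⟨(IntegrableOn.congr_fun (hsum.add hRint) (fun t ht => (hval t ht).symm)
    measurableSet_Icc), ?_⟩
  rw [setIntegral_congr_fun measurableSet_Icc hval, integral_add hsum hRint,
    integral_finsetSum _ fun j _ => integrable_finsetSum _ fun w _ => hterm j w,
    ← integral_prod_symm (fun y : (Fin p → ℝ) × (Fin p → ℝ) => taylorRem f ℓ u M s y.1 y.2) hRprod]
  have hR : ContinuesTo (polesOfOrder p f.totalDegree m) b ((m + p : ℝ) / f.totalDegree)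
      (fun s => ∫ y, taylorRem f ℓ u M s y.1 y.2 ∂prodCube (latticeMeasure p))
      (fun s => ∫ y, taylorRem f ℓ u M s y.1 y.2 ∂prodCube (latticeMeasure p)) :=
    .of_differentiableAt fun s hs => (integrable_and_differentiableAt_taylorRem_prodCube hf hℓ hc
      isOctantMeasure_latticeMeasure hu M hs).2
  -- The expansion of `Z` holds to the right of the abscissa by `integral_octant_eq` and extends by
  -- uniqueness; its coefficients are those of the expansion of `Ψ t`, averaged over the cube.
  rw [(hZ b).eq_of_eq_on ((ContinuesTo.sum (Finset.range M) fun j _ =>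
    ContinuesTo.sum Finset.univ fun w _ => (hψ j w).const_mul (cubeCoeff w)).add hR)
    (fun z hz => integral_octant_eq hf hℓ hc hu M hz) hbs hsP]
  congr 1
  refine Finset.sum_congr rfl fun j _ => ?_
  rw [integral_finsetSum _ fun w _ => hterm j w]
  exact Finset.sum_congr rfl fun w _ => (integral_mul_const _ _).symm

end ShiftExpansion

/-! ### Zeta integrals and zeta series -/

section Zeta

variable {p : ℕ} {f g : MvPolynomial (Fin p) ℂ} {ℓ ℓ' : (Fin p → ℝ) → ℂ}

theorem single_zero_mem_ofOrder (d : ℕ) (g : MvPolynomial (Fin p) ℂ) :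
    (Finsupp.single 0 g : FormalSymbol p) ∈ ofOrder d g.totalDegree :=
  single_mem_ofOrder (by simpa using mem_degLE_totalDegree)

theorem abscissa_eq : abscissa f g = (((g.totalDegree : ℤ) : ℝ) + p) / f.totalDegree := by
  simp [abscissa]

theorem zetaTerm_congr (h : ∀ x ∈ octant p, ℓ x = ℓ' x) (s : ℂ) {x : Fin p → ℝ}
    (hx : x ∈ octant p) : zetaTerm g ℓ s x = zetaTerm g ℓ' s x := by
  rw [zetaTerm, zetaTerm, h x hx]

theorem rawIntegral_congr (h : ∀ x ∈ octant p, ℓ x = ℓ' x) : rawIntegral g ℓ = rawIntegral g ℓ' :=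
  funext fun s => setIntegral_congr_fun measurableSet_octant fun _ hx => zetaTerm_congr h s hx

theorem rawSeries_congr (h : ∀ x ∈ octant p, ℓ x = ℓ' x) : rawSeries g ℓ = rawSeries g ℓ' :=
  funext fun s => tsum_congr fun k => zetaTerm_congr h s (latticePoint_mem_octant k)

theorem IsEllipticOnOctant.zetaWellDefined (hf : IsEllipticOnOctant f) (hℓ : IsLogBranch f ℓ) :
    ZetaWellDefined f g ℓ := by
  obtain ⟨hℓc, hc⟩ := hℓ.comp_octantProj
  set ℓc : (Fin p → ℝ) → ℂ := fun x => ℓ (octantProj x) with hℓcdef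
  have heq : ∀ x ∈ octant p, ℓ x = ℓc x := fun x hx => by rw [hℓcdef]; simp [octantProj_eq hx]
  have hu := single_zero_mem_ofOrder f.totalDegree g
  have hI : ∀ {μ : Measure (Fin p → ℝ)}, IsOctantMeasure μ → ∀ s : ℂ, abscissa f g < s.re →
      Integrable (fun x => zetaTerm g ℓc s x) μ := by
    intro μ hμ s hs
    rw [abscissa_eq] at hs
    simpa only [eval_single_zero] using
      (integrable_and_differentiableAt_eval hf hℓc hc hμ hu hs).1
  have hP : ∀ s ∈ possiblePoles f g, s.re ≤ abscissa f g := by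
    intro s hs
    rw [possiblePoles_eq] at hs
    rw [abscissa_eq]
    exact re_le_of_mem_polesOfOrder hs
  have hcontZ : ∀ b : ℝ, ∃ ψ, ContinuesTo (possiblePoles f g) b (abscissa f g)
      (rawIntegral g ℓ) ψ := by
    intro b
    obtain ⟨ψ, hψ⟩ := hasContinuations_volume hf hℓc hc _ _ hu b
    refine ⟨ψ, ?_⟩
    rw [possiblePoles_eq, abscissa_eq, rawIntegral_congr heq]
    exact hψ.congr fun s _ => by simp only [eval_single_zero, rawIntegral]
  have hcontS : ∀ b : ℝ, ∃ ψ, ContinuesTo (possiblePoles f g) b (abscissa f g)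
      (rawSeries g ℓ) ψ := by
    intro b
    obtain ⟨ψ, hψ⟩ := hasContinuations_latticeMeasure hf hℓc hc _ _ hu b
    refine ⟨ψ, ?_⟩
    rw [← possiblePoles_eq, ← abscissa_eq] at hψ
    rw [rawSeries_congr heq]
    refine hψ.congr fun s hs => ?_
    simp only [eval_single_zero]
    exact integral_latticeMeasure (hI isOctantMeasure_latticeMeasure s hs)
  obtain ⟨Z, hZ, hZa⟩ := exists_isMeromorphicContinuation hP hcontZ
  obtain ⟨S, hS, hSa⟩ := exists_isMeromorphicContinuation hP hcontS
  have hZe : zetaIntegral f g ℓ = Z := meromorphicContinuation_eq hZ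
  have hSe : zetaSeries f g ℓ = S := meromorphicContinuation_eq hS
  refine ⟨fun s hs => ?_, fun s hs => ?_, by rwa [hZe], by rwa [hSe], by rwa [hZe], by rwa [hSe]⟩
  · exact IntegrableOn.congr_fun (hI isOctantMeasure_volume s hs)
      (fun x hx => (zetaTerm_congr heq s hx).symm) measurableSet_octant
  · refine Summable.of_norm ?_
    refine (integrable_latticeMeasure_iff.1 (hI isOctantMeasure_latticeMeasure s hs)).congr
      fun k => ?_
    rw [zetaTerm_congr heq s (latticePoint_mem_octant k)]

theorem ZetaWellDefined.continuesTo_integral (h : ZetaWellDefined f g ℓ) (b : ℝ) :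
    ContinuesTo (possiblePoles f g) b (abscissa f g) (rawIntegral g ℓ) (zetaIntegral f g ℓ) where
  meromorphicAt _ _ := (h.integral_continuation.meromorphic (Set.mem_univ _)).meromorphicAt
  analyticAt s _ hs := h.integral_analyticAt s hs
  eq := h.integral_continuation.eq_of_re_gt

theorem ZetaWellDefined.continuesTo_series (h : ZetaWellDefined f g ℓ) (b : ℝ) :
    ContinuesTo (possiblePoles f g) b (abscissa f g) (rawSeries g ℓ) (zetaSeries f g ℓ) where
  meromorphicAt _ _ := (h.series_continuation.meromorphic (Set.mem_univ _)).meromorphicAt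
  analyticAt s _ hs := h.series_analyticAt s hs
  eq := h.series_continuation.eq_of_re_gt

theorem ContinuesTo.mul_left {P : Set ℂ} {b σ : ℝ} {φ ψ : ℂ → ℂ} {e : ℂ → ℂ}
    (he : Differentiable ℂ e) (h : ContinuesTo P b σ φ ψ) :
    ContinuesTo P b σ (fun s => e s * φ s) (fun s => e s * ψ s) where
  meromorphicAt s hs := (he.analyticAt s).meromorphicAt.mul (h.meromorphicAt s hs)
  analyticAt s hs hP := (he.analyticAt s).mul (h.analyticAt s hs hP)
  eq s hs := by rw [h.eq s hs]

theorem possiblePoles_shiftPoly (a : Fin p → ℝ) :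
    possiblePoles (shiftPoly a f) (shiftPoly a g) = possiblePoles f g := by
  simp only [possiblePoles, shiftPoly_totalDegree]

theorem abscissa_shiftPoly (a : Fin p → ℝ) :
    abscissa (shiftPoly a f) (shiftPoly a g) = abscissa f g := by
  simp only [abscissa, shiftPoly_totalDegree]

/-- Changing the branch by a constant κ costs only the entire factor e^(sκ), which does not affect
continuation or poles. -/
theorem eval_add_eq_exp_mul_zetaTerm {a : Fin p → ℝ} {κ : ℂ} (s : ℂ) {x : Fin p → ℝ}
    (h : ℓ' x = ℓ (a + x) + κ) :
    FormalSymbol.eval ℓ s (x + a) (Finsupp.single 0 g) =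
      Complex.exp (s * κ) * zetaTerm (shiftPoly a g) ℓ' s x := by
  rw [eval_single_zero, zetaTerm, zetaTerm, evalReal_shiftPoly, h, add_comm x a, mul_left_comm,
    ← Complex.exp_add]
  congr 2
  ring

/-- The zeta integral of a shift, formed with an arbitrary branch, in terms of the original
branch. -/
theorem continuesTo_zetaIntegral_shift (hf : IsEllipticOnOctant f) {a : Fin p → ℝ}
    (ha : a ∈ octant p) (hℓ' : IsLogBranch (shiftPoly a f) ℓ') {κ : ℂ}
    (hκ : ∀ x ∈ octant p, ℓ' x = ℓ (a + x) + κ) (b : ℝ) :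
    ContinuesTo (possiblePoles f g) b (abscissa f g)
      (fun s => ∫ x in octant p, FormalSymbol.eval ℓ s (x + a) (Finsupp.single 0 g))
      (fun s => Complex.exp (s * κ) * zetaIntegral (shiftPoly a f) (shiftPoly a g) ℓ' s) := by
  have h := ((hf.shift ha).zetaWellDefined (g := shiftPoly a g) hℓ').continuesTo_integral b
  rw [possiblePoles_shiftPoly, abscissa_shiftPoly] at h
  refine (h.mul_left (e := fun s => Complex.exp (s * κ)) (by fun_prop)).congr fun s _ => ?_
  rw [rawIntegral, ← integral_const_mul]
  exact setIntegral_congr_fun measurableSet_octant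
    fun x hx => (eval_add_eq_exp_mul_zetaTerm s (hκ x hx)).symm

theorem continuesTo_zetaSeries_shift (hf : IsEllipticOnOctant f) (hℓ : IsLogBranch f ℓ)
    (hc : Continuous ℓ) {a : Fin p → ℝ}
    (ha : a ∈ octant p) (hℓ' : IsLogBranch (shiftPoly a f) ℓ') {κ : ℂ}
    (hκ : ∀ x ∈ octant p, ℓ' x = ℓ (a + x) + κ) (b : ℝ) :
    ContinuesTo (possiblePoles f g) b (abscissa f g)
      (fun s => ∫ x, FormalSymbol.eval ℓ s (x + a) (Finsupp.single 0 g) ∂latticeMeasure p)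
      (fun s => Complex.exp (s * κ) * zetaSeries (shiftPoly a f) (shiftPoly a g) ℓ' s) := by
  have h := ((hf.shift ha).zetaWellDefined (g := shiftPoly a g) hℓ').continuesTo_series b
  rw [possiblePoles_shiftPoly, abscissa_shiftPoly] at h
  refine (h.mul_left (e := fun s => Complex.exp (s * κ)) (by fun_prop)).congr fun s hs => ?_
  rw [abscissa_eq] at hs
  rw [rawSeries, ← tsum_mul_left, integral_latticeMeasure (integrable_eval_add hf hℓ hc
    isOctantMeasure_latticeMeasure (single_zero_mem_ofOrder f.totalDegree g) ha hs)]
  exact tsum_congr fun k =>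
    (eval_add_eq_exp_mul_zetaTerm s (hκ _ (latticePoint_mem_octant k))).symm

theorem IsEllipticOnOctant.raabe (hf : IsEllipticOnOctant f) (hℓ : IsLogBranch f ℓ) {s : ℂ}
    (hs : s ∉ possiblePoles f g) :
    IntegrableOn (fun t => zetaSeries (shiftPoly t f) (shiftPoly t g) (fun x => ℓ (t + x)) s)
      (Set.Icc (0 : Fin p → ℝ) 1) ∧
    zetaIntegral f g ℓ s = ∫ t in Set.Icc (0 : Fin p → ℝ) 1,
      zetaSeries (shiftPoly t f) (shiftPoly t g) (fun x => ℓ (t + x)) s := by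
  obtain ⟨hℓc, hc⟩ := hℓ.comp_octantProj
  have heq : ∀ x ∈ octant p, ℓ x = ℓ (octantProj x) := fun x hx => by rw [octantProj_eq hx]
  refine integral_cube_continuation hf hℓc hc (single_zero_mem_ofOrder f.totalDegree g)
    (Ψ := fun t => zetaSeries (shiftPoly t f) (shiftPoly t g) fun x => ℓ (t + x))
    (fun b => ?_) (fun t ht b => ?_) (by rwa [← possiblePoles_eq])
  · rw [← possiblePoles_eq, ← abscissa_eq]
    refine ((hf.zetaWellDefined hℓ).continuesTo_integral b).congr fun s _ => ?_
    simp only [eval_single_zero]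
    rw [rawIntegral_congr heq, rawIntegral]
  · rw [← possiblePoles_eq, ← abscissa_eq]
    simpa using continuesTo_zetaSeries_shift (g := g) hf hℓc hc ht (hℓ.shift ht) (κ := 0)
      (fun x hx => by rw [add_zero]; exact heq _ (add_mem_octant ht hx)) b

/-- Two branches differ by an integer multiple of 2πi, so the correction factor is 1 at -N and the
values there do not depend on the branch. -/
theorem exp_neg_natCast_mul_eq_one (N : ℕ) (k : ℤ) :
    Complex.exp (-(N : ℂ) * (k * (2 * Real.pi * Complex.I))) = 1 := by
  rw [← mul_assoc]
  have := Complex.exp_int_mul_two_pi_mul_I (-N * k)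
  push_cast at this
  exact this

theorem IsLogBranch.shift_eq_add_const {a : Fin p → ℝ} (ha : a ∈ octant p) (hℓ : IsLogBranch f ℓ)
    (hℓ' : IsLogBranch (shiftPoly a f) ℓ') :
    ∃ k : ℤ, ∀ x ∈ octant p, ℓ' x = ℓ (a + x) + k * (2 * Real.pi * Complex.I) :=
  hℓ'.eq_add_const (hℓ.shift ha)

theorem IsEllipticOnOctant.exists_polynomial_zetaIntegral (hf : IsEllipticOnOctant f)
    (g : MvPolynomial (Fin p) ℂ) (N : ℕ) :
    ∃ P : MvPolynomial (Fin p) ℂ, P.totalDegree ≤ N * f.totalDegree + g.totalDegree + p ∧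
      ∀ a ∈ octant p, ∀ ℓ, IsLogBranch (shiftPoly a f) ℓ →
        zetaIntegral (shiftPoly a f) (shiftPoly a g) ℓ (-(N : ℂ)) = evalReal P a := by
  obtain ⟨ℓ₁, hℓ₁⟩ := hf.exists_isLogBranch
  obtain ⟨hℓ₀, hc⟩ := hℓ₁.comp_octantProj
  obtain ⟨P, hP, h⟩ := exists_polynomial_value hf hℓ₀ hc isOctantMeasure_volume
    (hasContinuations_volume hf hℓ₀ hc) (single_zero_mem_ofOrder f.totalDegree g) N
  refine ⟨P, hP, fun a ha ℓ hℓ => ?_⟩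
  obtain ⟨k, hk⟩ := hℓ₀.shift_eq_add_const ha hℓ
  rw [← h a ha _ fun b => by
    have := continuesTo_zetaIntegral_shift (g := g)
      (ℓ := fun x => ℓ₁ (octantProj x)) hf ha hℓ hk b
    rwa [possiblePoles_eq, abscissa_eq] at this]
  rw [exp_neg_natCast_mul_eq_one, one_mul]

theorem IsEllipticOnOctant.exists_polynomial_zetaSeries (hf : IsEllipticOnOctant f)
    (g : MvPolynomial (Fin p) ℂ) (N : ℕ) :
    ∃ Q : MvPolynomial (Fin p) ℂ, Q.totalDegree ≤ N * f.totalDegree + g.totalDegree + p ∧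
      ∀ a ∈ octant p, ∀ ℓ, IsLogBranch (shiftPoly a f) ℓ →
        zetaSeries (shiftPoly a f) (shiftPoly a g) ℓ (-(N : ℂ)) = evalReal Q a := by
  obtain ⟨ℓ₁, hℓ₁⟩ := hf.exists_isLogBranch
  obtain ⟨hℓ₀, hc⟩ := hℓ₁.comp_octantProj
  obtain ⟨Q, hQ, h⟩ := exists_polynomial_value hf hℓ₀ hc isOctantMeasure_latticeMeasure
    (hasContinuations_latticeMeasure hf hℓ₀ hc) (single_zero_mem_ofOrder f.totalDegree g) N
  refine ⟨Q, hQ, fun a ha ℓ hℓ => ?_⟩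
  obtain ⟨k, hk⟩ := hℓ₀.shift_eq_add_const ha hℓ
  rw [← h a ha _ fun b => by
    have := continuesTo_zetaSeries_shift (g := g) hf hℓ₀ hc ha hℓ hk b
    rwa [possiblePoles_eq, abscissa_eq] at this]
  rw [exp_neg_natCast_mul_eq_one, one_mul]

end Zeta

end

/-! ### Bernoulli polynomials and inversion of Raabe's formula -/

section Bernoulli

variable {p : ℕ}

theorem aeval_bernoulli_succ_one_add (n : ℕ) (z : ℂ) :
    Polynomial.aeval (1 + z) (Polynomial.bernoulli (n + 1)) =
      Polynomial.aeval z (Polynomial.bernoulli (n + 1)) + (n + 1) * z ^ n := by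
  have := congrArg (Polynomial.aeval z) (Polynomial.bernoulli_comp_one_add_X (n + 1))
  rw [Polynomial.aeval_comp] at this
  simpa using this

/-- B_(n+1)/(n+1) is a primitive of B_n, and B_(n+1)(a + 1) - B_(n+1)(a) = (n + 1) a^n. -/
theorem integral_Icc_aeval_bernoulli (n : ℕ) (a : ℝ) :
    ∫ t in Set.Icc (0 : ℝ) 1, Polynomial.aeval ((a + t : ℝ) : ℂ) (Polynomial.bernoulli n) =
      (a : ℂ) ^ n := by
  have hn : (n + 1 : ℂ) ≠ 0 := by exact_mod_cast Nat.succ_ne_zero n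
  rw [integral_Icc_eq_integral_Ioc, ← intervalIntegral.integral_of_le zero_le_one]
  have hder : ∀ t ∈ Set.uIcc (0 : ℝ) 1, HasDerivAt
      (fun t : ℝ => Polynomial.aeval ((a + t : ℝ) : ℂ) (Polynomial.bernoulli (n + 1)) / (n + 1))
      (Polynomial.aeval ((a + t : ℝ) : ℂ) (Polynomial.bernoulli n)) t := by
    intro t _
    have h1 := (Polynomial.bernoulli (n + 1)).hasDerivAt_aeval ((a + t : ℝ) : ℂ)
    have h2 : HasDerivAt (fun t : ℝ => ((a + t : ℝ) : ℂ)) 1 t := by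
      simpa using ((hasDerivAt_id t).const_add a).ofReal_comp
    have h3 := (h1.comp t h2).div_const ((n : ℂ) + 1)
    refine h3.congr_deriv ?_
    rw [Polynomial.derivative_bernoulli_add_one]
    simp only [map_mul, map_add, map_natCast, map_one, mul_one]
    field_simp
  have hcont : Continuous fun t : ℝ =>
      Polynomial.aeval ((a + t : ℝ) : ℂ) (Polynomial.bernoulli n) :=
    (Polynomial.continuous_aeval _).comp (by fun_prop)
  rw [intervalIntegral.integral_eq_sub_of_hasDerivAt hder (hcont.intervalIntegrable 0 1)]
  have := aeval_bernoulli_succ_one_add n (a : ℂ)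
  push_cast
  rw [add_comm (a : ℂ) 1, this, add_zero]
  field_simp
  ring

theorem integral_cube_prod (φ : Fin p → ℝ → ℂ) :
    ∫ t in Set.Icc (0 : Fin p → ℝ) 1, ∏ i, φ i (t i) = ∏ i, ∫ t in Set.Icc (0 : ℝ) 1, φ i t := by
  have : (volume : Measure (Fin p → ℝ)).restrict (Set.Icc 0 1) =
      Measure.pi fun _ => volume.restrict (Set.Icc (0 : ℝ) 1) := by
    rw [← Set.pi_univ_Icc, volume_pi, Measure.restrict_pi_pi]
    rfl
  rw [this, integral_fintype_prod_eq_prod]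

theorem integral_cube_bernoulliProd (L : Fin p →₀ ℕ) (a : Fin p → ℝ) :
    ∫ t in Set.Icc (0 : Fin p → ℝ) 1, bernoulliProd L (a + t) = ∏ i, (a i : ℂ) ^ L i := by
  simp only [bernoulliProd, Pi.add_apply]
  rw [integral_cube_prod fun i t =>
    Polynomial.aeval ((a i + t : ℝ) : ℂ) (Polynomial.bernoulli (L i))]
  exact Finset.prod_congr rfl fun i _ => integral_Icc_aeval_bernoulli (L i) (a i)

/-- The linear map sending a monomial `x^L` to the value `B_L(a)`. -/
noncomputable def bernoulliEval (a : Fin p → ℝ) : MvPolynomial (Fin p) ℂ →ₗ[ℂ] ℂ :=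
  (MvPolynomial.basisMonomials (Fin p) ℂ).constr ℂ fun L => bernoulliProd L a

theorem bernoulliEval_monomial (a : Fin p → ℝ) (L : Fin p →₀ ℕ) (c : ℂ) :
    bernoulliEval a (MvPolynomial.monomial L c) = c * bernoulliProd L a := by
  have h := (MvPolynomial.basisMonomials (Fin p) ℂ).constr_basis ℂ (fun L => bernoulliProd L a) L
  rw [MvPolynomial.coe_basisMonomials] at h
  have : MvPolynomial.monomial L c = c • MvPolynomial.monomial L (1 : ℂ) := by
    rw [MvPolynomial.smul_monomial, smul_eq_mul, mul_one]
  rw [this, map_smul, bernoulliEval, h, smul_eq_mul]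

theorem bernoulliEval_eq_sum (a : Fin p → ℝ) (q : MvPolynomial (Fin p) ℂ) :
    bernoulliEval a q = ∑ L ∈ q.support, q.coeff L * bernoulliProd L a := by
  conv_lhs => rw [q.as_sum, map_sum]
  exact Finset.sum_congr rfl fun L _ => bernoulliEval_monomial a L _

theorem continuous_bernoulliProd (L : Fin p →₀ ℕ) : Continuous (bernoulliProd L) := by
  unfold bernoulliProd
  exact continuous_finsetProd _ fun i _ => (Polynomial.continuous_aeval _).comp (by fun_prop)

/-- Averaging over the unit cube undoes the substitution of B_L for x^L. -/
theorem integral_cube_bernoulliEval (q : MvPolynomial (Fin p) ℂ) (a : Fin p → ℝ) :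
    ∫ t in Set.Icc (0 : Fin p → ℝ) 1, bernoulliEval (a + t) q = evalReal q a := by
  simp only [bernoulliEval_eq_sum]
  rw [integral_finsetSum, evalReal, MvPolynomial.eval_eq']
  · refine Finset.sum_congr rfl fun L _ => ?_
    rw [integral_const_mul, integral_cube_bernoulliProd]
  · intro L _
    exact (((continuous_bernoulliProd L).comp (continuous_const_add a)).const_mul
      _).continuousOn.integrableOn_compact isCompact_Icc

theorem pow_eq_sum_bernoulli (n : ℕ) (z : ℂ) :
    z ^ n = ∑ k ∈ Finset.range (n + 1), ((n + 1).choose k / (n + 1) : ℂ) *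
      Polynomial.aeval z (Polynomial.bernoulli k) := by
  have hn : (n + 1 : ℂ) ≠ 0 := by exact_mod_cast Nat.succ_ne_zero n
  have h := congrArg (Polynomial.aeval z) (Polynomial.sum_bernoulli n)
  rw [map_sum, Polynomial.aeval_monomial] at h
  have h' : ∑ k ∈ Finset.range (n + 1), ((n + 1).choose k : ℂ) *
      Polynomial.aeval z (Polynomial.bernoulli k) = (n + 1) * z ^ n := by
    rw [map_add, map_natCast, map_one] at h
    rw [← h]
    refine Finset.sum_congr rfl fun k _ => ?_
    rw [map_smul, Algebra.smul_def, map_natCast]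
  rw [← mul_right_inj' hn, ← h', Finset.mul_sum]
  refine Finset.sum_congr rfl fun k _ => ?_
  field_simp

/-- The products of Bernoulli polynomials span the polynomials. -/
theorem exists_bernoulliEval_eq (Q : MvPolynomial (Fin p) ℂ) :
    ∃ q : MvPolynomial (Fin p) ℂ, ∀ a, evalReal Q a = bernoulliEval a q := by
  refine degLE_induction (P := fun Q => ∃ q : MvPolynomial (Fin p) ℂ,
    ∀ a, evalReal Q a = bernoulliEval a q) ?_ ?_ ?_ (mem_degLE_totalDegree (g := Q))
  · exact ⟨0, by simp [evalReal]⟩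
  · rintro A B ⟨α, hα⟩ ⟨β, hβ⟩
    refine ⟨α + β, fun a => ?_⟩
    rw [map_add, ← hα, ← hβ, evalReal, map_add]
    rfl
  · intro L c _
    -- Expand each power x_i^(L_i) in Bernoulli polynomials and multiply out; `w` records the chosen
    -- index in each factor.
    refine ⟨∑ w ∈ Fintype.piFinset fun i => Finset.range (L i + 1),
      MvPolynomial.monomial (Finsupp.equivFunOnFinite.symm w)
        (c * ∏ i, ((L i + 1).choose (w i) / (L i + 1) : ℂ)), fun a => ?_⟩
    rw [map_sum, evalReal, MvPolynomial.eval_monomial, Finsupp.prod_fintype _ _ (by simp)]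
    simp only [pow_eq_sum_bernoulli, bernoulliEval_monomial]
    rw [Finset.prod_univ_sum, Finset.mul_sum]
    refine Finset.sum_congr rfl fun w _ => ?_
    rw [Finset.prod_mul_distrib, mul_assoc]
    rfl

theorem eq_of_evalReal_eq_on_octant {P q : MvPolynomial (Fin p) ℂ}
    (h : ∀ a ∈ octant p, evalReal P a = evalReal q a) : P = q := by
  refine MvPolynomial.funext_set (fun _ => Complex.ofReal '' Set.Ici 0)
    (fun _ => (Set.Ici_infinite 0).image Complex.ofReal_injective.injOn) fun x hx => ?_
  choose a ha hax using fun i => hx i (Set.mem_univ i)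
  have := h a ha
  simpa only [evalReal, hax] using this

/-- A polynomial is determined by its Raabe transform. -/
theorem evalReal_eq_bernoulliEval {P Q : MvPolynomial (Fin p) ℂ}
    (h : ∀ a ∈ octant p, evalReal P a = ∫ t in Set.Icc (0 : Fin p → ℝ) 1, evalReal Q (a + t))
    (a : Fin p → ℝ) : evalReal Q a = bernoulliEval a P := by
  obtain ⟨q, hq⟩ := exists_bernoulliEval_eq Q
  -- With `Q` written as the Bernoulli transform of `q`, its average over cubes is `q`, which
  -- therefore agrees with `P` on the octant.
  have : P = q := eq_of_evalReal_eq_on_octant fun a ha => by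
    rw [h a ha]
    simp only [hq, integral_cube_bernoulliEval]
  rw [hq, this]

theorem bernoulliProd_zero (L : Fin p →₀ ℕ) :
    bernoulliProd L 0 = ∏ i, ((bernoulli (L i) : ℚ) : ℂ) := by
  refine Finset.prod_congr rfl fun i _ => ?_
  have : ((0 : Fin p → ℝ) i : ℂ) = algebraMap ℚ ℂ 0 := by simp
  rw [this, Polynomial.aeval_algebraMap_apply, Polynomial.coe_aeval_eq_eval,
    Polynomial.bernoulli_eval_zero]
  rfl

theorem IsEllipticOnOctant.zetaSeries_neg_natCast_eq {f g : MvPolynomial (Fin p) ℂ}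
    (hf : IsEllipticOnOctant f) (N : ℕ) (P : MvPolynomial (Fin p) ℂ)
    (hP : ∀ a ∈ octant p, ∀ ℓ, IsLogBranch (shiftPoly a f) ℓ →
      zetaIntegral (shiftPoly a f) (shiftPoly a g) ℓ (-(N : ℂ)) = evalReal P a)
    {a : Fin p → ℝ} (ha : a ∈ octant p) {ℓ : (Fin p → ℝ) → ℂ}
    (hℓ : IsLogBranch (shiftPoly a f) ℓ) :
    zetaSeries (shiftPoly a f) (shiftPoly a g) ℓ (-(N : ℂ)) =
      ∑ L ∈ P.support, P.coeff L * bernoulliProd L a := by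
  obtain ⟨ℓ₀, hℓ₀⟩ := hf.exists_isLogBranch
  obtain ⟨Q, -, hQ⟩ := hf.exists_polynomial_zetaSeries g N
  rw [← bernoulliEval_eq_sum, hQ a ha ℓ hℓ]
  refine evalReal_eq_bernoulliEval (fun c hc => ?_) a
  -- Raabe's formula for f_c at -N, which is never a possible pole; shifting by c and then by t is
  -- shifting by c + t.
  rw [← hP c hc _ (hℓ₀.shift hc), ((hf.shift hc).raabe (g := shiftPoly c g) (hℓ₀.shift hc)
    fun h => h.2 N rfl).2]
  refine setIntegral_congr_fun measurableSet_Icc fun t ht => ?_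
  have hct := add_mem_octant hc (Icc_subset_octant ht)
  have h := (hℓ₀.shift hc).shift (Icc_subset_octant ht)
  simp only [shiftPoly_shiftPoly] at h ⊢
  exact hQ _ hct _ h

end Bernoulli

theorem mainTheorem3 {p : ℕ} (f g : MvPolynomial (Fin p) ℂ) (hf : MahlerHypothesis f) :
    -- the functions `Z(s; f_a, g_a)` and `ζ(s; f_a, g_a)` are well defined
    (∀ a ∈ octant p,
      (∃ ℓ, IsLogBranch (shiftPoly a f) ℓ) ∧
      ∀ ℓ, IsLogBranch (shiftPoly a f) ℓ →
        ZetaWellDefined (shiftPoly a f) (shiftPoly a g) ℓ) ∧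
    -- (1) the Raabe formula
    (∀ ℓ, IsLogBranch f ℓ → ∀ s ∉ possiblePoles f g,
      IntegrableOn
        (fun t => zetaSeries (shiftPoly t f) (shiftPoly t g) (fun x => ℓ (t + x)) s)
        (Set.Icc (0 : Fin p → ℝ) 1) ∧
      zetaIntegral f g ℓ s =
        ∫ t in Set.Icc (0 : Fin p → ℝ) 1,
          zetaSeries (shiftPoly t f) (shiftPoly t g) (fun x => ℓ (t + x)) s) ∧
    -- (2) polynomiality in `a`
    (∀ N : ℕ,
      (∃ Q : MvPolynomial (Fin p) ℂ,
        Q.totalDegree ≤ N * f.totalDegree + g.totalDegree + p ∧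
        ∀ a ∈ octant p, ∀ ℓ, IsLogBranch (shiftPoly a f) ℓ →
          zetaSeries (shiftPoly a f) (shiftPoly a g) ℓ (-(N : ℂ)) = evalReal Q a) ∧
      (∃ P : MvPolynomial (Fin p) ℂ,
        P.totalDegree ≤ N * f.totalDegree + g.totalDegree + p ∧
        ∀ a ∈ octant p, ∀ ℓ, IsLogBranch (shiftPoly a f) ℓ →
          zetaIntegral (shiftPoly a f) (shiftPoly a g) ℓ (-(N : ℂ)) = evalReal P a)) ∧
    -- (3) inversion of the Raabe formula at `s = -N`
    (∀ (N : ℕ) (P : MvPolynomial (Fin p) ℂ),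
      (∀ a ∈ octant p, ∀ ℓ, IsLogBranch (shiftPoly a f) ℓ →
        zetaIntegral (shiftPoly a f) (shiftPoly a g) ℓ (-(N : ℂ)) = evalReal P a) →
      (∀ a ∈ octant p, ∀ ℓ, IsLogBranch (shiftPoly a f) ℓ →
        zetaSeries (shiftPoly a f) (shiftPoly a g) ℓ (-(N : ℂ)) =
          ∑ L ∈ P.support, P.coeff L * bernoulliProd L a) ∧
      (∀ ℓ, IsLogBranch f ℓ →
        zetaSeries f g ℓ (-(N : ℂ)) =
          ∑ L ∈ P.support, P.coeff L * ∏ i, ((bernoulli (L i) : ℚ) : ℂ))) := by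
  have hE := hf.isEllipticOnOctant
  refine ⟨fun a ha => ⟨(hE.shift ha).exists_isLogBranch,
    fun ℓ hℓ => (hE.shift ha).zetaWellDefined hℓ⟩, fun ℓ hℓ s hs => hE.raabe hℓ hs,
    fun N => ⟨hE.exists_polynomial_zetaSeries g N, hE.exists_polynomial_zetaIntegral g N⟩,
    fun N P hP => ?_⟩
  have key := fun a (ha : a ∈ octant p) ℓ (hℓ : IsLogBranch (shiftPoly a f) ℓ) =>
    hE.zetaSeries_neg_natCast_eq N P hP ha hℓ
  refine ⟨key, fun ℓ hℓ => ?_⟩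
  have h := key 0 zero_mem_octant ℓ (by rwa [shiftPoly_zero])
  simpa only [shiftPoly_zero, bernoulliProd_zero] using h
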